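/- A function $\phi:(0,\infty)\to(0,\infty)$ is called admissible if $\phi$ and $\psi(r)=r/\phi(r)$ are both positive and non-decreasing on $(0,\infty)$ and $\psi(0^+)=0$. For $0<\alpha<1$ let $\mathrm{Lip}_\alpha(\mathbb C)$ be the space of bounded functions $f:\mathbb C\to\mathbb C$ with finite norm $\|f\|_{\mathrm{Lip}_\alpha}=\sup_{z\ne w}\frac{|f(z)-f(w)|}{|z-w|^\alpha}+\sup_{z}|f(z)|$, and let $\mathrm{lip}_\alpha(\mathbb C)$ consist of those $f\in \mathrm{Lip}_\alpha(\mathbb C)$ with $\lim_{\delta\to0^+}\sup_{0<|z-w|<\delta}\frac{|f(z)-f(w)|}{|z-w|^\alpha}=0$. For $U\subseteq\mathbb C$ let $A_\alpha(U)$ be the set of $f\in\mathrm{lip}_\alpha(\mathbb C)$ that are analytic in a neighborhood of $U$. A set $E\subseteq\mathbb C$ has full area density at $0$ if $m(B(0,r)\setminus E)/m(B(0,r))\to0$ as $r\to0^+$, where $m$ is two-dimensional Lebesgue (outer) measure. Let $A_n(0)=\{z:2^{-(n+1)}\le|z|\le2^{-n}\}$. A measure function is a non-decreasing $h:[0,\infty)\to[0,\infty)$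 with $h(t)\to0$ as $t\to0$; put $M^h(E)=\inf\sum_j h(s_j)$ over all countable covers of $E$ by squares with side lengths $s_j$, and let $M_*^{1+\alpha}(E)=\sup_h M^h(E)$ over all measure functions $h$ with $h(t)\le t^{1+\alpha}$ and $h(t)t^{-(1+\alpha)}\to0$ as $t\to0^+$. Theorem. Let $\phi$ be admissible with $\phi(0^+)=0$ and let $0<\alpha<1$. Then there are integers $1\le k_1<k_2<\cdots$ such that, with $a_n=\frac34 2^{-k_n}$ and $r_n>0$ defined by $r_n^{1+\alpha}=a_n^2n^{-1}\phi(a_n)$, each closed disk $\overline{B(a_n,r_n)}$ is contained in $A_{k_n}(0)$, and the set $$U=\{|z|<1\}\setminus\bigcup_{n=1}^\infty\overline{B(a_n,r_n)}$$ contains $0$, $U\setminus\{0\}$ is open, and the following hold: 1. for each $\epsilon>0$ the set $\{y\in U:\ |f(y)-f(0)-f'(0)y|\le\epsilon\,\phi(|y|)\,|y|\,\|f\|_{\mathrm{Lip}_\alpha}\ \text{for all } f\in A_\alpha(U)\}$ has full area density at $0$ (at $y=0$ the right-hand side is read as $0$); 2. $\displaystyle\sum_{n=1}^\infty\phi(2^{-n})^{-1}4^nM_*^{1+\alpha}(A_n(0)\setminus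 U)=\infty.$ -/

import Mathlib

open Set Filter Topology MeasureTheory Metric
open scoped NNReal ENNReal

noncomputable section

namespace LipAnalytic

/-- Admissible functions on `(0, ∞)`: `φ` is positive and non-decreasing, and the associated
function `ψ(r) = r / φ(r)` is positive and non-decreasing with `ψ(0⁺) = 0`. The values of `φ`
outside `(0, ∞)` play no role. -/
structure IsAdmissible (φ : ℝ → ℝ) : Prop where
  pos : ∀ r, 0 < r → 0 < φ r
  mono : MonotoneOn φ (Ioi 0)
  assoc_pos : ∀ r, 0 < r → 0 < r / φ r
  assoc_mono : MonotoneOn (fun r => r / φ r) (Ioi 0)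
  assoc_tendsto : Tendsto (fun r => r / φ r) (𝓝[>] 0) (𝓝 0)

/-- The closed dyadic annulus `A_n(x) = {z : 2^{-(n+1)} ≤ |z - x| ≤ 2^{-n}}`. -/
def annulus (x : ℂ) (n : ℕ) : Set ℂ :=
  {z | ((2 : ℝ) ^ (n + 1))⁻¹ ≤ ‖z - x‖ ∧ ‖z - x‖ ≤ ((2 : ℝ) ^ n)⁻¹}

/-- `E` has full area density at `x`. -/
def HasFullAreaDensity (E : Set ℂ) (x : ℂ) : Prop :=
  Tendsto (fun r : ℝ => volume (ball x r \ E) / volume (ball x r)) (𝓝[>] 0) (𝓝 0)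

/-- `f ∈ Lip_α(ℂ)`: `f` is bounded and `α`-Hölder on all of `ℂ`. -/
def MemLip (α : ℝ≥0) (f : ℂ → ℂ) : Prop :=
  MemHolder α f ∧ BddAbove (range fun z => ‖f z‖)

/-- The norm of `Lip_α(ℂ)`: the least Hölder constant plus the supremum norm. -/
def lipNorm (α : ℝ≥0) (f : ℂ → ℂ) : ℝ :=
  (nnHolderNorm α f : ℝ) + ⨆ z, ‖f z‖

/-- `f ∈ lip_α(ℂ)`, the little Lipschitz class. -/
def MemLittleLip (α : ℝ≥0) (f : ℂ → ℂ) : Prop :=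
  MemLip α f ∧ ∀ ε : ℝ, 0 < ε → ∃ δ : ℝ, 0 < δ ∧
    ∀ z w : ℂ, 0 < ‖z - w‖ → ‖z - w‖ < δ → ‖f z - f w‖ / ‖z - w‖ ^ (α : ℝ) ≤ ε

/-- `A_α(U)`: the functions of the little Lipschitz class that are analytic in a neighbourhood
of `U`. The set `U` need not be open; for open `U` this says that `f` is analytic on `U`. -/
def analyticLip (α : ℝ≥0) (U : Set ℂ) : Set (ℂ → ℂ) :=
  {f | MemLittleLip α f ∧ AnalyticOnNhd ℂ f U}

/-- The closed square with centre `c`, side length `s`, and sides parallel to the complex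
numbers `u` and `i u`, for `u` of modulus one. -/
def square (c : ℂ) (u : Circle) (s : ℝ≥0) : Set ℂ :=
  (fun z : ℂ => c + u * z) '' {z | |z.re| ≤ (s : ℝ) / 2 ∧ |z.im| ≤ (s : ℝ) / 2}

/-- A measure function: non-decreasing on `[0, ∞)` with `h(t) → 0` as `t → 0`. -/
def IsMeasureFunction (h : ℝ≥0 → ℝ≥0) : Prop :=
  Monotone h ∧ Tendsto h (𝓝 0) (𝓝 0)

/-- The Hausdorff content `M^h(E)`, an infimum over countable covers of `E` by squares. Squares
of side `0`, which have weight `h 0 = 0`, are allowed so that finite covers are included; since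
`h(t) → 0` as `t → 0` they do not change the infimum. -/
def hausdorffContent (h : ℝ≥0 → ℝ≥0) (E : Set ℂ) : ℝ≥0∞ :=
  ⨅ (c : ℕ → ℂ) (u : ℕ → Circle) (s : ℕ → ℝ≥0) (_ : E ⊆ ⋃ j, square (c j) (u j) (s j)),
    ∑' j, (h (s j) : ℝ≥0∞)

/-- The lower `β`-dimensional Hausdorff content `M_*^β(E)`. -/
def lowerHausdorffContent (β : ℝ) (E : Set ℂ) : ℝ≥0∞ :=
  ⨆ (h : ℝ≥0 → ℝ≥0) (_ : IsMeasureFunction h) (_ : ∀ t, h t ≤ t ^ β)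
    (_ : Tendsto (fun t => h t / t ^ β) (𝓝[>] 0) (𝓝 0)), hausdorffContent h E

/-- The open unit disk with the closed disks `closedBall (a n) (r n)` removed. -/
def perforatedDisk (a r : ℕ → ℝ) : Set ℂ :=
  ball 0 1 \ ⋃ n, closedBall (a n : ℂ) (r n)

end LipAnalytic

end

open LipAnalytic

noncomputable section

namespace LipAnalytic

/-- The Cauchy transform of `f` along the circle with centre `a` and radius `r`. -/
def circleCauchy (f : ℂ → ℂ) (a : ℂ) (r : ℝ) (w : ℂ) : ℂ :=
  (2 * Real.pi * Complex.I)⁻¹ • ∮ z in C(a, r), (z - w)⁻¹ • f z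

/-- The derivative of the Cauchy transform of `f` along a circle, as an integral. -/
def circleCauchyDeriv (f : ℂ → ℂ) (a : ℂ) (r : ℝ) (w : ℂ) : ℂ :=
  (2 * Real.pi * Complex.I)⁻¹ • ∮ z in C(a, r), ((z - w) ^ 2)⁻¹ • f z

section CircleCauchy

variable {f : ℂ → ℂ} {a : ℂ} {r M : ℝ}

theorem sub_ne_zero_of_mem_sphere {x : ℂ} (hx : x ∉ sphere a r) {z : ℂ} (hz : z ∈ sphere a r) :
    z - x ≠ 0 := by
  rw [sub_ne_zero]
  rintro rfl
  exact hx hz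

theorem circleIntegrable_inv_smul (hr : 0 ≤ r) (hf : ContinuousOn f (sphere a r)) {x : ℂ}
    (hx : x ∉ sphere a r) : CircleIntegrable (fun z => (z - x)⁻¹ • f z) a r := by
  apply ContinuousOn.circleIntegrable hr
  refine ContinuousOn.smul (ContinuousOn.inv₀ (continuousOn_id.sub continuousOn_const) ?_) hf
  exact fun z hz => sub_ne_zero_of_mem_sphere hx hz

theorem circleIntegrable_sq_inv_smul (hr : 0 ≤ r) (hf : ContinuousOn f (sphere a r)) {x : ℂ}
    (hx : x ∉ sphere a r) : CircleIntegrable (fun z => ((z - x) ^ 2)⁻¹ • f z) a r := by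
  apply ContinuousOn.circleIntegrable hr
  refine ContinuousOn.smul
    (ContinuousOn.inv₀ ((continuousOn_id.sub continuousOn_const).pow 2) ?_) hf
  exact fun z hz => pow_ne_zero 2 (sub_ne_zero_of_mem_sphere hx hz)

/-- Bound for the Cauchy transform away from the circle. -/
theorem norm_circleCauchy_le (hr : 0 ≤ r) (hM : ∀ z ∈ sphere a r, ‖f z‖ ≤ M) {w : ℂ} {d : ℝ}
    (hd : 0 < d) (hw : ∀ z ∈ sphere a r, d ≤ ‖z - w‖) :
    ‖circleCauchy f a r w‖ ≤ r * (M / d) := by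
  refine circleIntegral.norm_two_pi_i_inv_smul_integral_le_of_norm_le_const hr fun z hz => ?_
  rw [norm_smul, norm_inv, div_eq_inv_mul]
  exact mul_le_mul (inv_anti₀ hd (hw z hz)) (hM z hz) (norm_nonneg _) (by positivity)

/-- First-order Taylor estimate for the Cauchy transform, with an explicit remainder. -/
theorem norm_circleCauchy_taylor_le (hr : 0 ≤ r) (hf : ContinuousOn f (sphere a r))
    (hM : ∀ z ∈ sphere a r, ‖f z‖ ≤ M) {x y : ℂ} {d e : ℝ} (hd : 0 < d) (he : 0 < e)
    (hx : ∀ z ∈ sphere a r, d ≤ ‖z - x‖) (hy : ∀ z ∈ sphere a r, e ≤ ‖z - y‖) :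
    ‖circleCauchy f a r y - circleCauchy f a r x - circleCauchyDeriv f a r x * (y - x)‖
      ≤ r * (M * ‖y - x‖ ^ 2 / (d ^ 2 * e)) := by
  have hx' : x ∉ sphere a r := fun h => by simpa using hd.trans_le (hx x h)
  have hy' : y ∉ sphere a r := fun h => by simpa using he.trans_le (hy y h)
  have key : circleCauchy f a r y - circleCauchy f a r x - circleCauchyDeriv f a r x * (y - x) =
      (2 * Real.pi * Complex.I)⁻¹ •
        ∮ z in C(a, r), ((y - x) ^ 2 / ((z - x) ^ 2 * (z - y))) • f z := by
    have h1 := circleIntegrable_inv_smul hr hf hx'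
    have h2 := circleIntegrable_inv_smul hr hf hy'
    have h3 : CircleIntegrable (fun z => (y - x) • ((z - x) ^ 2)⁻¹ • f z) a r :=
      (circleIntegrable_sq_inv_smul hr hf hx').const_smul
    have : ∮ z in C(a, r), ((y - x) ^ 2 / ((z - x) ^ 2 * (z - y))) • f z =
        ∮ z in C(a, r), ((z - y)⁻¹ • f z - (z - x)⁻¹ • f z) -
          (y - x) • ((z - x) ^ 2)⁻¹ • f z := by
      apply circleIntegral.integral_congr hr
      intro z hz
      have e1 := sub_ne_zero_of_mem_sphere hx' hz
      have e2 := sub_ne_zero_of_mem_sphere hy' hz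
      simp only [smul_eq_mul]
      field_simp
      ring
    have h4 : CircleIntegrable (fun z => (z - y)⁻¹ • f z - (z - x)⁻¹ • f z) a r := h2.sub h1
    rw [this, circleIntegral.integral_sub h4 h3, circleIntegral.integral_sub h2 h1,
      circleIntegral.integral_smul]
    simp only [circleCauchy, circleCauchyDeriv, smul_eq_mul]
    ring
  rw [key]
  refine circleIntegral.norm_two_pi_i_inv_smul_integral_le_of_norm_le_const hr fun z hz => ?_
  have h1 := hx z hz
  have h2 := hy z hz
  have hM0 : 0 ≤ M := (norm_nonneg _).trans (hM z hz)
  rw [norm_smul, norm_div, norm_mul, norm_pow, norm_pow, mul_comm M, mul_div_right_comm]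
  gcongr
  exact hM z hz

theorem exists_dist_sphere_pos {x : ℂ} (hx : x ∉ sphere a r) :
    ∃ d > 0, ∀ z ∈ sphere a r, d ≤ ‖z - x‖ := by
  refine ⟨|‖x - a‖ - r|, abs_pos.2 ?_, fun z hz => ?_⟩
  · simpa [sub_eq_zero, dist_eq_norm] using hx
  · rw [mem_sphere, dist_eq_norm] at hz
    have := abs_norm_sub_norm_le (x - a) (z - a)
    rw [hz] at this
    rwa [sub_sub_sub_cancel_right, norm_sub_rev x z] at this

theorem hasDerivAt_circleCauchy (hr : 0 ≤ r) (hf : ContinuousOn f (sphere a r)) {x : ℂ}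
    (hx : x ∉ sphere a r) :
    HasDerivAt (circleCauchy f a r) (circleCauchyDeriv f a r x) x := by
  obtain ⟨d, hd, hdx⟩ := exists_dist_sphere_pos hx
  obtain ⟨M, hM⟩ := (isCompact_sphere a r).exists_bound_of_continuousOn hf
  rw [hasDerivAt_iff_isLittleO]
  have hO : (fun y => circleCauchy f a r y - circleCauchy f a r x -
      (y - x) • circleCauchyDeriv f a r x) =O[𝓝 x] fun y => ‖y - x‖ ^ 2 := by
    refine Asymptotics.IsBigO.of_bound (r * (M / (d ^ 2 * (d / 2)))) ?_
    filter_upwards [ball_mem_nhds x (half_pos hd)] with y hy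
    rw [mem_ball, dist_eq_norm] at hy
    have := norm_circleCauchy_taylor_le hr hf hM hd (half_pos hd) hdx (y := y) (fun z hz => by
      have h1 := hdx z hz
      have h2 := norm_sub_le_norm_sub_add_norm_sub z y x
      linarith)
    rw [smul_eq_mul, mul_comm (y - x), norm_pow, norm_norm]
    refine this.trans (le_of_eq ?_)
    ring
  refine hO.trans_isLittleO ?_
  have : (fun y => ‖y - x‖ ^ 2) =o[𝓝 x] fun y => ‖y - x‖ := by
    have h0 : Tendsto (fun y => ‖y - x‖) (𝓝 x) (𝓝 0) := by
      have : Continuous fun y => ‖y - x‖ := by fun_prop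
      simpa using this.tendsto x
    exact (Asymptotics.isLittleO_pow_id one_lt_two).comp_tendsto h0
  exact this.of_norm_right

/-- The Cauchy integral formula on an annulus. -/
theorem circleCauchy_annulus {R : ℝ} (hr : 0 < r) {w : ℂ}
    (hc : ContinuousOn f (closedBall a R \ ball a r))
    (hd : ∀ z ∈ ball a R \ closedBall a r, DifferentiableAt ℂ f z)
    (hw : w ∈ ball a R \ closedBall a r) :
    circleCauchy f a R w = f w + circleCauchy f a r w := by
  have hrw : r < dist w a := by simpa using hw.2
  have hwR : dist w a < R := by simpa using hw.1
  have hrR := hrw.trans hwR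
  have hR : 0 < R := hr.trans hrR
  have hsR : sphere a R ⊆ closedBall a R \ ball a r := fun z hz => by
    rw [mem_sphere] at hz; simp [hz, hrR.le]
  have hsr : sphere a r ⊆ closedBall a R \ ball a r := fun z hz => by
    rw [mem_sphere] at hz; simp [hz, hrR.le]
  have hwsR : w ∉ sphere a R := fun h => hwR.ne (mem_sphere.1 h)
  have hwsr : w ∉ sphere a r := fun h => hrw.ne' (mem_sphere.1 h)
  have hnhds : closedBall a R \ ball a r ∈ 𝓝 w :=
    mem_of_superset ((isOpen_ball.sdiff isClosed_closedBall).mem_nhds hw)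
      (sdiff_subset_sdiff ball_subset_closedBall ball_subset_closedBall)
  have heq := Complex.circleIntegral_eq_of_differentiable_on_annulus_off_countable hr hrR.le
    (f := dslope f w) (countable_singleton w) ((continuousOn_dslope hnhds).2 ⟨hc, hd w hw⟩)
    (fun z hz => (differentiableAt_dslope_of_ne hz.2).2 (hd z hz.1))
  have hrep : ∀ ρ : ℝ, 0 < ρ → sphere a ρ ⊆ closedBall a R \ ball a r → w ∉ sphere a ρ →
      ∮ z in C(a, ρ), dslope f w z = (∮ z in C(a, ρ), (z - w)⁻¹ • f z) -
        (∮ z in C(a, ρ), (z - w)⁻¹) * f w := by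
    intro ρ hρ hs hwρ
    have : ∮ z in C(a, ρ), dslope f w z =
        ∮ z in C(a, ρ), (z - w)⁻¹ • f z - (z - w)⁻¹ • f w := by
      apply circleIntegral.integral_congr hρ.le
      intro z hz
      have hzw : z ≠ w := by rintro rfl; exact hwρ hz
      simp only
      rw [dslope_of_ne _ hzw, slope_def_module, smul_sub]
    rw [this, circleIntegral.integral_sub
      (circleIntegrable_inv_smul hρ.le (hc.mono hs) hwρ)
      (circleIntegrable_inv_smul (f := fun _ => f w) hρ.le continuousOn_const hwρ),
      circleIntegral.integral_smul_const, smul_eq_mul]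
  have hzero : ∮ z in C(a, r), (z - w)⁻¹ = 0 := by
    have hne : ∀ z ∈ closedBall a r, z - w ≠ 0 := fun z hz h => by
      rw [sub_eq_zero] at h; subst h; exact hw.2 hz
    refine Complex.circleIntegral_eq_zero_of_differentiable_on_off_countable hr.le
      countable_empty (ContinuousOn.inv₀ (by fun_prop) hne) fun z hz => ?_
    exact DifferentiableAt.inv (by fun_prop) (hne z (ball_subset_closedBall hz.1))
  rw [hrep R hR hsR hwsR, hrep r hr hsr hwsr, hzero,
    circleIntegral.integral_sub_inv_of_mem_ball hw.1, zero_mul, sub_zero] at heq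
  have hpi : (2 * Real.pi * Complex.I : ℂ) ≠ 0 := Complex.two_pi_I_ne_zero
  simp only [circleCauchy]
  rw [← heq, smul_eq_mul, smul_eq_mul]
  field_simp
  ring

/-- The Cauchy transform along the boundary of a disk removes the singularities inside it. -/
theorem exists_extension_across_closedBall {V : Set ℂ} (hV : IsOpen V) (hr : 0 < r)
    (haV : closedBall a r ⊆ V) (hc : ContinuousOn f V)
    (hd : DifferentiableOn ℂ f (V \ closedBall a r)) :
    ∃ F : ℂ → ℂ, DifferentiableOn ℂ F V ∧
      ∀ w ∈ V \ closedBall a r, F w = f w + circleCauchy f a r w := by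
  classical
  obtain ⟨δ, hδ, hδV⟩ := (isCompact_closedBall a r).exists_cthickening_subset_open hV haV
  rw [cthickening_closedBall hδ.le hr.le] at hδV
  set R := δ + r with hRdef
  have hR : 0 < R := by positivity
  have hrR : r < R := by linarith
  have hW : IsOpen (V \ closedBall a r) := hV.sdiff isClosed_closedBall
  have hann : ∀ w ∈ ball a R \ closedBall a r,
      circleCauchy f a R w = f w + circleCauchy f a r w := fun w hw =>
    circleCauchy_annulus hr (hc.mono (sdiff_subset.trans hδV))
      (fun z hz => hd.differentiableAt (hW.mem_nhds ⟨hδV (ball_subset_closedBall hz.1), hz.2⟩)) hw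
  set F : ℂ → ℂ := fun w => if w ∈ ball a R then circleCauchy f a R w
    else f w + circleCauchy f a r w with hF
  have hFeq : ∀ w ∈ V \ closedBall a r, F w = f w + circleCauchy f a r w := by
    intro w hw
    by_cases hwR : w ∈ ball a R
    · simp only [hF, if_pos hwR]
      exact hann w ⟨hwR, hw.2⟩
    · simp only [hF, if_neg hwR]
  refine ⟨F, fun w hw => DifferentiableAt.differentiableWithinAt ?_, hFeq⟩
  by_cases hwR : w ∈ ball a R
  · have h1 : F =ᶠ[𝓝 w] circleCauchy f a R := by
      filter_upwards [isOpen_ball.mem_nhds hwR] with z hz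
      simp only [hF, if_pos hz]
    refine (hasDerivAt_circleCauchy hR.le (hc.mono (sphere_subset_closedBall.trans hδV))
      fun h => ?_).differentiableAt.congr_of_eventuallyEq h1
    exact (mem_ball.1 hwR).ne (mem_sphere.1 h)
  · have hwr : w ∉ closedBall a r := fun h => hwR (closedBall_subset_ball hrR h)
    have h1 : F =ᶠ[𝓝 w] fun z => f z + circleCauchy f a r z := by
      filter_upwards [hW.mem_nhds ⟨hw, hwr⟩] with z hz using hFeq z hz
    refine DifferentiableAt.congr_of_eventuallyEq ?_ h1
    exact (hd.differentiableAt (hW.mem_nhds ⟨hw, hwr⟩)).add (hasDerivAt_circleCauchy hr.le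
      (hc.mono (sphere_subset_closedBall.trans haV))
      fun h => hwr (sphere_subset_closedBall h)).differentiableAt

end CircleCauchy

/-- A continuous function that is holomorphic off finitely many disjoint closed disks is, off these
disks, the difference of a function holomorphic across the disks and of Cauchy transforms along
their boundaries. -/
theorem exists_extension_across_closedBalls {f : ℂ → ℂ} {V : Set ℂ} (hV : IsOpen V)
    {ι : Type*} (s : Finset ι) (a : ι → ℂ) (r : ι → ℝ) (hr : ∀ i ∈ s, 0 < r i)
    (haV : ∀ i ∈ s, closedBall (a i) (r i) ⊆ V)
    (hdisj : ∀ i ∈ s, ∀ j ∈ s, i ≠ j → Disjoint (closedBall (a i) (r i)) (closedBall (a j) (r j)))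
    (hc : ContinuousOn f V)
    (hd : DifferentiableOn ℂ f (V \ ⋃ i ∈ s, closedBall (a i) (r i))) (c : ι → ℂ) :
    ∃ F : ℂ → ℂ, DifferentiableOn ℂ F V ∧
      ∀ w ∈ V \ ⋃ i ∈ s, closedBall (a i) (r i),
        F w = f w + ∑ i ∈ s, circleCauchy (fun z => f z - c i) (a i) (r i) w := by
  classical
  set D : ι → Set ℂ := fun i => closedBall (a i) (r i) with hD
  set g : ι → ℂ → ℂ := fun i => circleCauchy (fun z => f z - c i) (a i) (r i) with hg
  have hVi : ∀ i, IsOpen (V \ ⋃ j ∈ s.erase i, D j) := fun i =>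
    hV.sdiff (isClosed_biUnion_finset fun _ _ => isClosed_closedBall)
  have hex : ∀ i ∈ s, ∃ F : ℂ → ℂ, DifferentiableOn ℂ F (V \ ⋃ j ∈ s.erase i, D j) ∧
      ∀ w ∈ V \ ⋃ j ∈ s, D j, F w = f w + g i w := by
    intro i hi
    have hset : (V \ ⋃ j ∈ s.erase i, D j) \ D i = V \ ⋃ j ∈ s, D j := by
      rw [sdiff_sdiff]
      congr 1
      conv_rhs => rw [← Finset.insert_erase hi, Finset.set_biUnion_insert]
      rw [union_comm]
    obtain ⟨F, hF, hFe⟩ := exists_extension_across_closedBall (f := fun z => f z - c i) (hVi i)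
      (hr i hi) (a := a i) (subset_sdiff.2 ⟨haV i hi, by
        rw [disjoint_iUnion₂_right]
        exact fun j hj => hdisj i hi j (Finset.mem_of_mem_erase hj) (Finset.ne_of_mem_erase hj).symm⟩)
      ((hc.mono sdiff_subset).sub continuousOn_const) (by
        change DifferentiableOn ℂ _ (_ \ D i)
        rw [hset]; exact hd.sub_const _)
    refine ⟨fun w => F w + c i, hF.add_const _, fun w hw => ?_⟩
    have := hFe w (by change w ∈ _ \ D i; rwa [hset])
    simp only [this, hg]
    ring
  choose! G hGd hGe using hex
  have hgd : ∀ i ∈ s, ∀ w ∈ V \ D i, DifferentiableAt ℂ (g i) w := fun i hi w hw =>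
    (hasDerivAt_circleCauchy (hr i hi).le
      ((hc.mono (sphere_subset_closedBall.trans (haV i hi))).sub continuousOn_const)
      fun h => hw.2 (sphere_subset_closedBall h)).differentiableAt
  set F : ℂ → ℂ := fun w =>
    if h : ∃ i ∈ s, w ∈ D i then G h.choose w + ∑ j ∈ s.erase h.choose, g j w
    else f w + ∑ j ∈ s, g j w with hF
  have hFoff : ∀ w ∈ V \ ⋃ i ∈ s, D i, F w = f w + ∑ j ∈ s, g j w := by
    intro w hw
    have : ¬ ∃ i ∈ s, w ∈ D i := by simpa using hw.2
    simp only [hF, dif_neg this]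
  have hFi : ∀ i ∈ s, ∀ w ∈ V \ ⋃ j ∈ s.erase i, D j, F w = G i w + ∑ j ∈ s.erase i, g j w := by
    intro i hi w hw
    by_cases h : ∃ i ∈ s, w ∈ D i
    · have hch : h.choose = i := by
        by_contra hne
        exact hw.2 (mem_biUnion (Finset.mem_erase.2 ⟨hne, h.choose_spec.1⟩) h.choose_spec.2)
      simp only [hF, dif_pos h, hch]
    · have hw' : w ∈ V \ ⋃ i ∈ s, D i := ⟨hw.1, by simpa using h⟩
      rw [hFoff w hw', hGe i hi w hw', ← Finset.add_sum_erase s _ hi, add_assoc]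
  refine ⟨F, fun w hw => DifferentiableAt.differentiableWithinAt ?_, hFoff⟩
  by_cases h : ∃ i ∈ s, w ∈ D i
  · obtain ⟨i, hi, hwi⟩ := h
    have hwV : w ∈ V \ ⋃ j ∈ s.erase i, D j := by
      refine ⟨hw, fun h => ?_⟩
      obtain ⟨j, hj, hwj⟩ := mem_iUnion₂.1 h
      exact (hdisj i hi j (Finset.mem_of_mem_erase hj) (Finset.ne_of_mem_erase hj).symm).le_bot
        ⟨hwi, hwj⟩
    have h1 : F =ᶠ[𝓝 w] fun z => G i z + ∑ j ∈ s.erase i, g j z := by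
      filter_upwards [(hVi i).mem_nhds hwV] with z hz using hFi i hi z hz
    refine DifferentiableAt.congr_of_eventuallyEq ?_ h1
    refine ((hGd i hi).differentiableAt ((hVi i).mem_nhds hwV)).add
      (DifferentiableAt.fun_sum fun j hj => hgd j (Finset.mem_of_mem_erase hj) w ⟨hw, fun h => ?_⟩)
    exact hwV.2 (mem_biUnion hj h)
  · have hwV : w ∈ V \ ⋃ j ∈ s, D j := ⟨hw, by simpa using h⟩
    have ho : IsOpen (V \ ⋃ j ∈ s, D j) :=
      hV.sdiff (isClosed_biUnion_finset fun _ _ => isClosed_closedBall)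
    have h1 : F =ᶠ[𝓝 w] fun z => f z + ∑ j ∈ s, g j z := by
      filter_upwards [ho.mem_nhds hwV] with z hz using hFoff z hz
    refine DifferentiableAt.congr_of_eventuallyEq ?_ h1
    exact (hd.differentiableAt (ho.mem_nhds hwV)).add
      (DifferentiableAt.fun_sum fun j hj => hgd j hj w ⟨hw, fun hj' => h ⟨j, hj, hj'⟩⟩)

/-- Second-order Taylor remainder of a holomorphic function at the centre of a disk. -/
theorem norm_taylor_le_of_differentiableOn {F : ℂ → ℂ} {R M : ℝ} (hR : 0 < R)
    (hF : DiffContOnCl ℂ F (ball 0 R)) (hM : ∀ z ∈ sphere (0 : ℂ) R, ‖F z‖ ≤ M) {y : ℂ}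
    (hy : ‖y‖ < R) :
    ‖F y - F 0 - deriv F 0 * y‖ ≤ M * ‖y‖ ^ 2 / (R * (R - ‖y‖)) := by
  have hFc : ContinuousOn F (sphere 0 R) :=
    hF.continuousOn.mono (by rw [closure_ball _ hR.ne']; exact sphere_subset_closedBall)
  have hrep : ∀ w ∈ ball (0 : ℂ) R, circleCauchy F 0 R w = F w := fun w hw =>
    hF.two_pi_i_inv_smul_circleIntegral_sub_inv_smul hw
  have h0 : (0 : ℂ) ∈ ball (0 : ℂ) R := mem_ball_self hR
  have hder : deriv F 0 = circleCauchyDeriv F 0 R 0 := by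
    have h1 : F =ᶠ[𝓝 0] circleCauchy F 0 R := by
      filter_upwards [isOpen_ball.mem_nhds h0] with z hz using (hrep z hz).symm
    rw [h1.deriv_eq]
    exact (hasDerivAt_circleCauchy hR.le hFc (by simpa using hR.ne)).deriv
  have hs : ∀ z ∈ sphere (0 : ℂ) R, ‖z‖ = R := fun z hz => by simpa using hz
  have := norm_circleCauchy_taylor_le hR.le hFc hM hR (sub_pos.2 hy) (x := 0) (y := y)
    (fun z hz => by rw [sub_zero, hs z hz])
    (fun z hz => by have := norm_sub_norm_le z y; rwa [hs z hz] at this)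
  rw [hrep y (by simpa using hy), hrep 0 h0, ← hder, sub_zero] at this
  refine this.trans (le_of_eq ?_)
  have : R - ‖y‖ ≠ 0 := (sub_pos.2 hy).ne'
  field_simp

theorem square_subset_closedBall (c : ℂ) (u : Circle) (s : ℝ≥0) :
    square c u s ⊆ closedBall c s := by
  rintro _ ⟨z, ⟨h1, h2⟩, rfl⟩
  rw [mem_closedBall, dist_eq_norm, add_sub_cancel_left, norm_mul, Circle.norm_coe, one_mul]
  exact (Complex.norm_le_abs_re_add_abs_im z).trans (by linarith)

theorem hausdorffContent_mono (h : ℝ≥0 → ℝ≥0) {E F : Set ℂ} (hEF : E ⊆ F) :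
    hausdorffContent h E ≤ hausdorffContent h F :=
  iInf_mono fun _ => iInf_mono fun _ => iInf_mono fun _ => iInf_mono' fun hc =>
    ⟨hEF.trans hc, le_rfl⟩

theorem lowerHausdorffContent_mono (β : ℝ) {E F : Set ℂ} (hEF : E ⊆ F) :
    lowerHausdorffContent β E ≤ lowerHausdorffContent β F :=
  iSup_mono fun h => iSup_mono fun _ => iSup_mono fun _ => iSup_mono fun _ =>
    hausdorffContent_mono h hEF

theorem sq_le_tsum_of_subset_iUnion_square {c : ℂ} {r : ℝ≥0} {x : ℕ → ℂ} {u : ℕ → Circle}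
    {s : ℕ → ℝ≥0} (h : closedBall c r ⊆ ⋃ j, square (x j) (u j) (s j)) :
    (r : ℝ≥0∞) ^ 2 ≤ ∑' j, (s j : ℝ≥0∞) ^ 2 := by
  have h1 : volume (closedBall c (r : ℝ)) ≤ ∑' j, volume (closedBall (x j) (s j : ℝ)) :=
    (measure_mono (h.trans (iUnion_mono fun j => square_subset_closedBall _ _ _))).trans
      (measure_iUnion_le _)
  simp only [Complex.volume_closedBall, ENNReal.ofReal_coe_nnreal, ENNReal.tsum_mul_right] at h1
  refine (ENNReal.mul_le_mul_iff_left ?_ ENNReal.coe_ne_top).1 h1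
  simpa using NNReal.pi_pos.ne'

/-- The lower `(1 + α)`-dimensional content of a disk is at least its radius to the power
`1 + α`. -/
theorem rpow_le_lowerHausdorffContent_closedBall {α : ℝ≥0} (hα1 : α < 1) (c : ℂ) {r : ℝ≥0}
    (hr : 0 < r) :
    ((r ^ (1 + (α : ℝ)) : ℝ≥0) : ℝ≥0∞) ≤
      lowerHausdorffContent (1 + (α : ℝ)) (closedBall c r) := by
  have hα1' : (α : ℝ) < 1 := by exact_mod_cast hα1
  have hα0' : 0 ≤ (α : ℝ) := α.coe_nonneg
  set h : ℝ≥0 → ℝ≥0 := fun t => t ^ (1 + (α : ℝ)) * min 1 ((t / r) ^ (1 - (α : ℝ))) with hh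
  have hle : ∀ t, h t ≤ t ^ (1 + (α : ℝ)) := fun t =>
    mul_le_of_le_one_right zero_le (min_le_left _ _)
  have hmono : Monotone h := by
    intro s t hst
    simp only [hh]
    gcongr
  have hlim1 : Tendsto (fun t : ℝ≥0 => t ^ (1 + (α : ℝ))) (𝓝 0) (𝓝 0) := by
    have : Continuous fun t : ℝ≥0 => t ^ (1 + (α : ℝ)) := NNReal.continuous_rpow_const (by linarith)
    simpa [NNReal.zero_rpow (by linarith : 1 + (α : ℝ) ≠ 0)] using this.tendsto 0
  have hlim2 : Tendsto (fun t : ℝ≥0 => (t / r) ^ (1 - (α : ℝ))) (𝓝 0) (𝓝 0) := by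
    have : Continuous fun t : ℝ≥0 => (t / r) ^ (1 - (α : ℝ)) :=
      (NNReal.continuous_rpow_const (by linarith)).comp (continuous_id.div_const _)
    simpa [NNReal.zero_rpow (by linarith : 1 - (α : ℝ) ≠ 0)] using this.tendsto 0
  have hmeas : IsMeasureFunction h :=
    ⟨hmono, tendsto_of_tendsto_of_tendsto_of_le_of_le tendsto_const_nhds hlim1
      (fun _ => zero_le) hle⟩
  have hsmall : Tendsto (fun t => h t / t ^ (1 + (α : ℝ))) (𝓝[>] 0) (𝓝 0) := by
    refine tendsto_of_tendsto_of_tendsto_of_le_of_le' tendsto_const_nhds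
      (hlim2.mono_left nhdsWithin_le_nhds) (Eventually.of_forall fun _ => zero_le) ?_
    filter_upwards [self_mem_nhdsWithin] with t ht
    have ht0 : t ^ (1 + (α : ℝ)) ≠ 0 := (NNReal.rpow_pos ht).ne'
    simp only [hh]
    rw [mul_div_cancel_left₀ _ ht0]
    exact min_le_right _ _
  have hrr : h r = r ^ (1 + (α : ℝ)) := by simp [hh, div_self hr.ne']
  have hsq : ∀ t ≤ r, r ^ (1 + (α : ℝ)) * t ^ 2 = h t * r ^ 2 := by
    intro t ht
    rcases eq_or_ne t 0 with rfl | ht0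
    · simp [hh, NNReal.zero_rpow (by linarith : 1 + (α : ℝ) ≠ 0)]
    have hmin : min 1 ((t / r) ^ (1 - (α : ℝ))) = (t / r) ^ (1 - (α : ℝ)) :=
      min_eq_right (NNReal.rpow_le_one (div_le_one_of_le₀ ht zero_le) (by linarith))
    have e1 : ∀ s : ℝ≥0, s ≠ 0 → s ^ 2 = s ^ (1 + (α : ℝ)) * s ^ (1 - (α : ℝ)) := fun s hs => by
      rw [← NNReal.rpow_add hs, ← NNReal.rpow_natCast]; norm_num
    simp only [hh]
    rw [hmin, e1 t ht0, e1 r hr.ne', NNReal.div_rpow]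
    have : r ^ (1 - (α : ℝ)) ≠ 0 := (NNReal.rpow_pos hr).ne'
    field_simp
  refine le_trans ?_ (le_iSup₂_of_le h hmeas (le_iSup₂_of_le hle hsmall le_rfl))
  refine le_iInf fun x => le_iInf fun u => le_iInf fun s => le_iInf fun hcov => ?_
  by_cases hs : ∃ j, r < s j
  · obtain ⟨j, hj⟩ := hs
    refine le_trans ?_ (ENNReal.le_tsum j)
    rw [← hrr]
    exact_mod_cast hmono hj.le
  · push Not at hs
    have h1 := sq_le_tsum_of_subset_iUnion_square hcov
    have hr2 : (r : ℝ≥0∞) ^ 2 ≠ 0 := by simpa using hr.ne'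
    have hr2' : (r : ℝ≥0∞) ^ 2 ≠ ⊤ := by simp
    rw [← ENNReal.mul_le_mul_iff_left hr2 hr2', ← ENNReal.tsum_mul_right]
    calc ((r ^ (1 + (α : ℝ)) : ℝ≥0) : ℝ≥0∞) * (r : ℝ≥0∞) ^ 2
        ≤ ((r ^ (1 + (α : ℝ)) : ℝ≥0) : ℝ≥0∞) * ∑' j, (s j : ℝ≥0∞) ^ 2 := by gcongr
      _ = ∑' j, (h (s j) : ℝ≥0∞) * (r : ℝ≥0∞) ^ 2 := by
        rw [← ENNReal.tsum_mul_left]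
        refine tsum_congr fun j => ?_
        exact_mod_cast hsq (s j) (hs j)

/-- Sequences that decay so fast that disks centred at the points `a n` do not interact. -/
structure IsSparse (φ : ℝ → ℝ) (a : ℕ → ℝ) : Prop where
  pos : ∀ n, 0 < a n
  le_pow : ∀ n, a n ≤ (1 / 2) ^ n
  le_three_eighths : ∀ n, a n ≤ 3 / 8
  quarter : ∀ i j, i < j → a j ≤ a i / 4
  phi_le : ∀ n, φ (a n) ≤ 1 / 16
  phi_decay : ∀ i j, i < j → φ (a j) ≤ φ (a i) * (1 / 2) ^ j
  quot_decay : ∀ i j, i < j → φ (a i) / a i ≤ φ (a j) / a j * (1 / 4) ^ j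

theorem IsAdmissible.quot_anti {φ : ℝ → ℝ} (hφ : IsAdmissible φ) {s t : ℝ} (hs : 0 < s)
    (hst : s ≤ t) : φ t / t ≤ φ s / s := by
  have h := hφ.assoc_mono hs (hs.trans_le hst) hst
  have := inv_anti₀ (hφ.assoc_pos s hs) h
  simpa using this

theorem IsAdmissible.le_two_mul {φ : ℝ → ℝ} (hφ : IsAdmissible φ) {s t : ℝ} (hs : 0 < s)
    (ht : 0 < t) (hts : t ≤ 2 * s) : φ t ≤ 2 * φ s := by
  have hps := hφ.pos s hs
  rcases le_total t s with h | h
  · have := hφ.mono ht hs h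
    linarith
  · have := hφ.quot_anti hs h
    rw [div_le_div_iff₀ ht hs] at this
    nlinarith

namespace IsSparse

variable {φ : ℝ → ℝ} {a : ℕ → ℝ}

theorem anti (ha : IsSparse φ a) : Antitone a := by
  intro i j hij
  rcases hij.eq_or_lt with rfl | h
  · rfl
  · have := ha.quarter i j h
    have := ha.pos i
    linarith

theorem exists_lt (ha : IsSparse φ a) {s : ℝ} (hs : 0 < s) : ∃ n, a n < s := by
  obtain ⟨n, hn⟩ := exists_pow_lt_of_lt_one hs (by norm_num : (1 / 2 : ℝ) < 1)
  exact ⟨n, (ha.le_pow n).trans_lt hn⟩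

/-- Each term of the interaction sum, where `p + 1` is the first index with `a n < 2 * ‖y‖`. -/
theorem interaction_le (hφ : IsAdmissible φ) (ha : IsSparse φ a) {y : ℂ} (hy0 : y ≠ 0)
    (hy : ∀ n, a n / (2 * √(n + 1)) ≤ ‖y - a n‖) {p : ℕ} (hp : a (p + 1) < 2 * ‖y‖)
    (hlt : ∀ n ≤ p, 2 * ‖y‖ ≤ a n) (n : ℕ) :
    φ (a n) / ((n + 1) * ‖y - a n‖) ≤ (φ ‖y‖ / ‖y‖) *
      (4 / (p + 2) * (1 / 2) ^ n + (if n = p then 8 / √(p + 1) else 0) +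
        (if n = p + 1 then 8 / √(p + 1) else 0)) := by
  set ρ := ‖y‖ with hρdef
  have hρ : 0 < ρ := norm_pos_iff.2 hy0
  have han := ha.pos n
  have hφn := hφ.pos _ han
  have hφρ := hφ.pos _ hρ
  have hnan : ‖(a n : ℂ)‖ = a n := by simp [abs_of_pos han]
  have hP : 0 < φ ρ / ρ := by positivity
  have hn1 : (1 : ℝ) ≤ n + 1 := by linarith [(Nat.cast_nonneg n : (0 : ℝ) ≤ n)]
  have hif1 : (0 : ℝ) ≤ if n = p then 8 / √((p : ℝ) + 1) else 0 := by split_ifs <;> positivity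
  have hif2 : (0 : ℝ) ≤ if n = p + 1 then 8 / √((p : ℝ) + 1) else 0 := by split_ifs <;> positivity
  have hgeo : (0 : ℝ) ≤ 4 / (p + 2) * (1 / 2) ^ n := by positivity
  have hsq1 : √((n : ℝ) + 1) ≤ n + 1 := Real.sqrt_le_iff.2 ⟨by positivity, by nlinarith⟩
  have hsq0 : 0 < √((n : ℝ) + 1) := by positivity
  have hfar : 2 * ρ ≤ a n → φ (a n) / ((n + 1) * ‖y - a n‖) ≤ 2 * (φ (a n) / a n) / (n + 1) := by
    intro h
    have h1 : a n / 2 ≤ ‖y - a n‖ := by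
      have := norm_sub_norm_le (a n : ℂ) y
      rw [norm_sub_rev, hnan] at this
      linarith
    calc φ (a n) / ((n + 1) * ‖y - a n‖) ≤ φ (a n) / ((n + 1) * (a n / 2)) := by gcongr
      _ = _ := by field_simp
  have hnear : a n ≤ ρ / 2 → φ (a n) / ((n + 1) * ‖y - a n‖) ≤ 2 * (φ (a n) / ρ) / (n + 1) := by
    intro h
    have h1 : ρ / 2 ≤ ‖y - a n‖ := by
      have := norm_sub_norm_le y (a n : ℂ)
      rw [hnan] at this
      linarith
    calc φ (a n) / ((n + 1) * ‖y - a n‖) ≤ φ (a n) / ((n + 1) * (ρ / 2)) := by gcongr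
      _ = _ := by field_simp
  rcases lt_trichotomy n p with hnp | rfl | hnp
  · have h1 := hfar (hlt n hnp.le)
    have h2 := ha.quot_decay n p hnp
    have h3 := hφ.quot_anti hρ (by linarith [hlt p le_rfl] : ρ ≤ a p)
    have h4 : 2 * (φ (a n) / a n) / (n + 1) ≤ 2 * (φ (a n) / a n) :=
      div_le_self (by positivity) hn1
    have h5 : (2 : ℝ) * (1 / 4) ^ p ≤ 4 / (p + 2) * (1 / 2) ^ n := by
      have e1 : (1 / 4 : ℝ) ^ p = (1 / 2) ^ p * (1 / 2) ^ p := by rw [← mul_pow]; norm_num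
      have e2 : (1 / 2 : ℝ) ^ p ≤ (1 / 2) ^ n :=
        pow_le_pow_of_le_one (by norm_num) (by norm_num) hnp.le
      have e3 : (2 : ℝ) * (1 / 2) ^ p ≤ 4 / (p + 2) := by
        have : (p : ℝ) + 2 ≤ 2 * 2 ^ p := by
          have : p + 1 < 2 ^ (p + 1) := Nat.lt_two_pow_self
          have : p + 2 ≤ 2 * 2 ^ p := by rw [pow_succ] at this; omega
          exact_mod_cast this
        rw [le_div_iff₀ (by positivity), one_div, inv_pow, mul_assoc, ← div_eq_inv_mul,
          ← mul_div_assoc, div_le_iff₀ (by positivity)]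
        linarith
      rw [e1, ← mul_assoc]
      gcongr
    have h6 : φ (a p) / a p * (1 / 4) ^ p ≤ φ ρ / ρ * (1 / 4) ^ p := by gcongr
    calc φ (a n) / ((n + 1) * ‖y - a n‖) ≤ φ ρ / ρ * (2 * (1 / 4) ^ p) := by linarith
      _ ≤ _ := by gcongr; linarith
  · have h1 := hfar (hlt n le_rfl)
    have h3 := hφ.quot_anti hρ (by linarith [hlt n le_rfl] : ρ ≤ a n)
    have h2 : 2 / ((n : ℝ) + 1) ≤ 8 / √(n + 1) := by
      gcongr; norm_num
    calc φ (a n) / ((n + 1) * ‖y - a n‖) ≤ 2 * (φ (a n) / a n) / (n + 1) := h1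
      _ ≤ 2 * (φ ρ / ρ) / (n + 1) := by gcongr
      _ = φ ρ / ρ * (2 / (n + 1)) := by ring
      _ ≤ _ := by rw [if_pos rfl]; gcongr; linarith
  · rcases (Nat.succ_le_of_lt hnp).eq_or_lt with h | h
    · have hn : n = p + 1 := h.symm
      have hsle : √((p : ℝ) + 1) ≤ √(n + 1) := by
        apply Real.sqrt_le_sqrt
        have : (p : ℝ) ≤ n := by exact_mod_cast hnp.le
        linarith
      have h8 : 8 / √((n : ℝ) + 1) ≤ 8 / √(p + 1) := by gcongr
      have h2ρ : a n < 2 * ρ := hn ▸ hp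
      have h2 := hφ.le_two_mul hρ han h2ρ.le
      have goal' : φ (a n) / ((n + 1) * ‖y - a n‖) ≤ φ ρ / ρ * (8 / √(n + 1)) := by
        by_cases hc : a n ≤ ρ / 2
        · have h3 : 4 / ((n : ℝ) + 1) ≤ 8 / √(n + 1) := by gcongr; norm_num
          calc φ (a n) / ((n + 1) * ‖y - a n‖) ≤ 2 * (φ (a n) / ρ) / (n + 1) := hnear hc
            _ ≤ 2 * (2 * φ ρ / ρ) / (n + 1) := by gcongr
            _ = φ ρ / ρ * (4 / (n + 1)) := by ring
            _ ≤ _ := by gcongr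
        · push Not at hc
          have hs : √((n : ℝ) + 1) * √(n + 1) = n + 1 := Real.mul_self_sqrt (by positivity)
          have hyn := hy n
          calc φ (a n) / ((n + 1) * ‖y - a n‖)
              ≤ 2 * φ ρ / ((n + 1) * (ρ / 2 / (2 * √(n + 1)))) := by
                gcongr
                exact le_trans (by gcongr) hyn
            _ = φ ρ / ρ * (8 / √(n + 1)) := by
                generalize √((n : ℝ) + 1) = q at hs hsq0
                rw [← hs]
                field_simp
                norm_num
      refine goal'.trans ?_
      rw [if_pos hn]
      gcongr
      linarith
    · have hq := ha.quarter (p + 1) n h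
      have h1 := hnear (by linarith)
      have h2 := ha.phi_decay (p + 1) n h
      have h3 := hφ.le_two_mul hρ (ha.pos _) hp.le
      have h4 : (p : ℝ) + 2 ≤ n + 1 := by
        have : p + 2 ≤ n + 1 := by omega
        exact_mod_cast this
      calc φ (a n) / ((n + 1) * ‖y - a n‖) ≤ 2 * (φ (a n) / ρ) / (n + 1) := h1
        _ ≤ 2 * (2 * φ ρ * (1 / 2) ^ n / ρ) / (p + 2) := by
          gcongr
          exact h2.trans (by gcongr)
        _ = φ ρ / ρ * (4 / (p + 2) * (1 / 2) ^ n) := by ring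
        _ ≤ _ := by gcongr; linarith

theorem sum_half_pow_le (N : ℕ) : ∑ n ∈ Finset.range N, (1 / 2 : ℝ) ^ n ≤ 2 := by
  exact (summable_geometric_two.sum_le_tsum _ fun _ _ => by positivity).trans
    tsum_geometric_two.le

/-- The interaction sum is small compared with `φ ‖y‖ / ‖y‖`, away from the points `a n`. -/
theorem sum_interaction_le (hφ : IsAdmissible φ) (ha : IsSparse φ a) {ε : ℝ} (hε : 0 < ε) :
    ∃ R > 0, ∀ y : ℂ, y ≠ 0 → ‖y‖ < R → (∀ n, a n / (2 * √(n + 1)) ≤ ‖y - a n‖) →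
      ∀ N : ℕ, ∑ n ∈ Finset.range N, φ (a n) / ((n + 1) * ‖y - a n‖) ≤ ε * (φ ‖y‖ / ‖y‖) := by
  have hlim : Tendsto (fun M : ℕ => 24 / √((M : ℝ) + 1)) atTop (𝓝 0) := by
    refine Tendsto.div_atTop tendsto_const_nhds ?_
    exact Real.tendsto_sqrt_atTop.comp
      (tendsto_atTop_add_const_right _ _ tendsto_natCast_atTop_atTop)
  obtain ⟨M, hM⟩ := (hlim.eventually_lt_const hε).exists
  refine ⟨a M / 2, half_pos (ha.pos M), fun y hy0 hyR hy N => ?_⟩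
  have hρ : 0 < ‖y‖ := norm_pos_iff.2 hy0
  have hex := ha.exists_lt (by linarith : 0 < 2 * ‖y‖)
  classical
  have hm := Nat.find_spec hex
  have hmin : ∀ n < Nat.find hex, 2 * ‖y‖ ≤ a n := fun n hn => not_lt.1 (Nat.find_min hex hn)
  have hMm : M < Nat.find hex := by
    by_contra hc
    have := ha.anti (not_lt.1 hc)
    linarith
  obtain ⟨p, hp⟩ : ∃ p, Nat.find hex = p + 1 := ⟨Nat.find hex - 1, by omega⟩
  rw [hp] at hm hmin hMm
  have hterm := ha.interaction_le hφ hy0 hy hm (fun n hn => hmin n (by omega))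
  have hP : 0 < φ ‖y‖ / ‖y‖ := div_pos (hφ.pos _ hρ) hρ
  have hpM : √((M : ℝ) + 1) ≤ √((p : ℝ) + 1) := by
    apply Real.sqrt_le_sqrt
    have : (M : ℝ) ≤ p := by exact_mod_cast Nat.lt_succ_iff.1 hMm
    linarith
  have hs0 : 0 < √((p : ℝ) + 1) := by positivity
  have hsp : √((p : ℝ) + 1) ≤ p + 2 := Real.sqrt_le_iff.2 ⟨by positivity, by nlinarith⟩
  have hite : ∀ q : ℕ, ∑ n ∈ Finset.range N, (if n = q then 8 / √((p : ℝ) + 1) else 0) ≤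
      8 / √((p : ℝ) + 1) := fun q => by
    rw [Finset.sum_ite_eq']
    split_ifs
    · exact le_rfl
    · positivity
  calc ∑ n ∈ Finset.range N, φ (a n) / ((n + 1) * ‖y - a n‖)
      ≤ ∑ n ∈ Finset.range N, (φ ‖y‖ / ‖y‖) *
      (4 / (p + 2) * (1 / 2) ^ n + (if n = p then 8 / √((p : ℝ) + 1) else 0) +
        (if n = p + 1 then 8 / √((p : ℝ) + 1) else 0)) := Finset.sum_le_sum fun n _ => hterm n
    _ = (φ ‖y‖ / ‖y‖) * (4 / (p + 2) * ∑ n ∈ Finset.range N, (1 / 2 : ℝ) ^ n +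
        ∑ n ∈ Finset.range N, (if n = p then 8 / √((p : ℝ) + 1) else 0) +
        ∑ n ∈ Finset.range N, (if n = p + 1 then 8 / √((p : ℝ) + 1) else 0)) := by
      rw [← Finset.mul_sum, Finset.sum_add_distrib, Finset.sum_add_distrib, Finset.mul_sum]
    _ ≤ (φ ‖y‖ / ‖y‖) * (4 / √((p : ℝ) + 1) * 2 + 8 / √((p : ℝ) + 1) + 8 / √((p : ℝ) + 1)) := by
      gcongr
      · exact sum_half_pow_le N
      · exact hite p
      · exact hite (p + 1)
    _ = (φ ‖y‖ / ‖y‖) * (24 / √((p : ℝ) + 1)) := by ring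
    _ ≤ (φ ‖y‖ / ‖y‖) * ε := by
      gcongr
      exact le_trans (by gcongr) hM.le
    _ = _ := mul_comm _ _

end IsSparse

/-- First-order Taylor estimate at `0` for a bounded Hölder function that is holomorphic in the unit
disk off finitely many small disjoint disks with real centres. -/
theorem norm_taylor_le_of_differentiableOn_diff {f : ℂ → ℂ} {α K : ℝ≥0} {B : ℝ} (hα : 0 < α)
    (hK : HolderWith K α f) (hB : ∀ z, ‖f z‖ ≤ B) {s : Finset ℕ} {a r : ℕ → ℝ}
    (ha : ∀ n ∈ s, a n ≤ 3 / 8) (hr : ∀ n ∈ s, 0 < r n) (hra : ∀ n ∈ s, r n ≤ a n / 4)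
    (hdisj : ∀ i ∈ s, ∀ j ∈ s, i ≠ j →
      Disjoint (closedBall (a i : ℂ) (r i)) (closedBall (a j : ℂ) (r j)))
    (hd : DifferentiableOn ℂ f (ball 0 1 \ ⋃ n ∈ s, closedBall (a n : ℂ) (r n)))
    {y : ℂ} (hy : ‖y‖ ≤ 1 / 4) (hyr : ∀ n ∈ s, 2 * r n ≤ ‖y - a n‖) :
    ‖f y - f 0 - deriv f 0 * y‖ ≤
      3 * ‖y‖ ^ 2 * (B + 4 * K * ∑ n ∈ s, r n ^ (1 + (α : ℝ))) +
      4 * K * ‖y‖ ^ 2 * ∑ n ∈ s, r n ^ (1 + (α : ℝ)) / (a n ^ 2 * ‖y - a n‖) := by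
  have hcont : Continuous f := hK.continuous hα
  have hapos : ∀ n ∈ s, 0 < a n := fun n hn => by linarith [hr n hn, hra n hn]
  have hnorm : ∀ n ∈ s, ‖(a n : ℂ)‖ = a n := fun n hn => by simp [abs_of_pos (hapos n hn)]
  have hball : ∀ n ∈ s, closedBall (a n : ℂ) (r n) ⊆ ball 0 1 := fun n hn => by
    apply closedBall_subset_ball'
    rw [dist_zero_right, hnorm n hn]
    linarith [ha n hn, hra n hn]
  obtain ⟨F, hFd, hF⟩ := exists_extension_across_closedBalls isOpen_ball s
    (fun n => (a n : ℂ)) r hr hball hdisj hcont.continuousOn hd (fun n => f (a n))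
  set g : ℕ → ℂ → ℂ := fun n => circleCauchy (fun z => f z - f (a n)) (a n : ℂ) (r n) with hg
  set g' : ℕ → ℂ := fun n => circleCauchyDeriv (fun z => f z - f (a n)) (a n : ℂ) (r n) 0 with hg'
  have hfc : ∀ n, ContinuousOn (fun z => f z - f (a n)) (sphere (a n : ℂ) (r n)) := fun n =>
    (hcont.sub continuous_const).continuousOn
  have hbd : ∀ n, ∀ z ∈ sphere (a n : ℂ) (r n), ‖f z - f (a n)‖ ≤ K * r n ^ (α : ℝ) :=
    fun n z hz => by
      have := hK.dist_le z (a n)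
      rwa [mem_sphere.1 hz, dist_eq_norm] at this
  have hpow : ∀ n ∈ s, r n * r n ^ (α : ℝ) = r n ^ (1 + (α : ℝ)) := fun n hn => by
    rw [Real.rpow_add (hr n hn), Real.rpow_one]
  have hd0 : ∀ n ∈ s, ∀ z ∈ sphere (a n : ℂ) (r n), 3 / 4 * a n ≤ ‖z - 0‖ := fun n hn z hz => by
    have h1 := norm_sub_norm_le (a n : ℂ) z
    rw [norm_sub_rev, ← dist_eq_norm, mem_sphere.1 hz, hnorm n hn] at h1
    rw [sub_zero]
    linarith [hra n hn]
  have hoff : ∀ w : ℂ, ‖w‖ < 1 → (∀ n ∈ s, r n < ‖w - a n‖) →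
      w ∈ ball (0 : ℂ) 1 \ ⋃ n ∈ s, closedBall (a n : ℂ) (r n) := fun w h1 h2 => by
    refine ⟨by simpa using h1, fun h => ?_⟩
    obtain ⟨n, hn, hw⟩ := mem_iUnion₂.1 h
    rw [mem_closedBall, dist_eq_norm] at hw
    linarith [h2 n hn]
  have hy1 := hoff y (by linarith) fun n hn => by linarith [hyr n hn, hr n hn]
  have h01 := hoff 0 (by simp) fun n hn => by
    rw [zero_sub, norm_neg, hnorm n hn]; linarith [hra n hn, hapos n hn]
  have hdF : deriv F 0 = deriv f 0 + ∑ n ∈ s, g' n := by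
    have ho : IsOpen (ball (0 : ℂ) 1 \ ⋃ n ∈ s, closedBall (a n : ℂ) (r n)) :=
      isOpen_ball.sdiff (isClosed_biUnion_finset fun _ _ => isClosed_closedBall)
    have h1 : F =ᶠ[𝓝 0] fun w => f w + ∑ n ∈ s, g n w := by
      filter_upwards [ho.mem_nhds h01] with w hw using hF w hw
    rw [h1.deriv_eq]
    refine HasDerivAt.deriv (HasDerivAt.add
      (hd.differentiableAt (ho.mem_nhds h01)).hasDerivAt (HasDerivAt.fun_sum fun n hn => ?_))
    refine hasDerivAt_circleCauchy (hr n hn).le (hfc n) fun h => ?_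
    exact h01.2 (mem_biUnion (x := n) hn (sphere_subset_closedBall h))
  have hdecomp : f y - f 0 - deriv f 0 * y = (F y - F 0 - deriv F 0 * y) -
      ∑ n ∈ s, (g n y - g n 0 - g' n * (y - 0)) := by
    rw [hF y hy1, hF 0 h01, hdF, Finset.sum_sub_distrib, Finset.sum_sub_distrib,
      ← Finset.sum_mul]
    simp only [hg]
    ring
  have hFbd : ∀ z ∈ sphere (0 : ℂ) (3 / 4),
      ‖F z‖ ≤ B + 4 * K * ∑ n ∈ s, r n ^ (1 + (α : ℝ)) := by
    intro z hz
    have hz' : ‖z‖ = 3 / 4 := by simpa using hz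
    have hdist : ∀ n ∈ s, 3 / 4 - a n ≤ ‖z - a n‖ := fun n hn => by
      have := norm_sub_norm_le z (a n : ℂ)
      rwa [hz', hnorm n hn] at this
    have hz1 := hoff z (by rw [hz']; norm_num) fun n hn => by
      linarith [hdist n hn, hra n hn, ha n hn]
    rw [hF z hz1]
    refine (norm_add_le _ _).trans (add_le_add (hB z) ((norm_sum_le _ _).trans ?_))
    rw [Finset.mul_sum]
    refine Finset.sum_le_sum fun n hn => ?_
    have := norm_circleCauchy_le (hr n hn).le (hbd n) (w := z) (d := 1 / 4) (by norm_num)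
      fun w hw => by
        have h1 := norm_sub_le_norm_sub_add_norm_sub z w (a n : ℂ)
        rw [← dist_eq_norm w, mem_sphere.1 hw, norm_sub_rev z w] at h1
        linarith [hdist n hn, hra n hn, ha n hn]
    refine this.trans (le_of_eq ?_)
    rw [← hpow n hn]
    ring
  have hmain : ‖F y - F 0 - deriv F 0 * y‖ ≤
      3 * ‖y‖ ^ 2 * (B + 4 * K * ∑ n ∈ s, r n ^ (1 + (α : ℝ))) := by
    have hcl : closedBall (0 : ℂ) (3 / 4) ⊆ ball 0 1 := closedBall_subset_ball (by norm_num)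
    have := norm_taylor_le_of_differentiableOn (by norm_num : (0 : ℝ) < 3 / 4)
      (DifferentiableOn.diffContOnCl (by
        rw [closure_ball _ (by norm_num)]; exact hFd.mono hcl)) hFbd (y := y) (by linarith)
    have hM : 0 ≤ B + 4 * K * ∑ n ∈ s, r n ^ (1 + (α : ℝ)) :=
      (norm_nonneg _).trans (hFbd ((3 / 4 : ℝ) : ℂ) (by simp))
    refine this.trans ?_
    rw [div_le_iff₀ (by nlinarith)]
    have h1 : (1 : ℝ) ≤ 3 * (3 / 4 * (3 / 4 - ‖y‖)) := by linarith
    nlinarith [mul_nonneg hM (sq_nonneg ‖y‖)]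
  have hgbd : ∀ n ∈ s, ‖g n y - g n 0 - g' n * (y - 0)‖ ≤
      4 * K * ‖y‖ ^ 2 * (r n ^ (1 + (α : ℝ)) / (a n ^ 2 * ‖y - a n‖)) := by
    intro n hn
    have hrn := hr n hn
    have han := hapos n hn
    have hyn : 0 < ‖y - a n‖ := by linarith [hyr n hn]
    have := norm_circleCauchy_taylor_le hrn.le (hfc n) (hbd n) (by positivity : 0 < 3 / 4 * a n)
      (half_pos hyn) (hd0 n hn) (y := y) fun z hz => by
        have h1 := norm_sub_le_norm_sub_add_norm_sub y z (a n : ℂ)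
        rw [← dist_eq_norm z, mem_sphere.1 hz, norm_sub_rev y z] at h1
        linarith [hyr n hn]
    refine this.trans ?_
    rw [← hpow n hn, sub_zero]
    have e : r n * (K * r n ^ (α : ℝ) * ‖y‖ ^ 2 / ((3 / 4 * a n) ^ 2 * (‖y - a n‖ / 2))) =
        32 / 9 * (K * ‖y‖ ^ 2 * (r n * r n ^ (α : ℝ) / (a n ^ 2 * ‖y - a n‖))) := by
      field_simp
      ring
    have : 0 ≤ K * ‖y‖ ^ 2 * (r n * r n ^ (α : ℝ) / (a n ^ 2 * ‖y - a n‖)) := by positivity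
    rw [e]
    linarith
  rw [hdecomp, Finset.mul_sum (a := 4 * K * ‖y‖ ^ 2)]
  exact (norm_sub_le _ _).trans (add_le_add hmain
    ((norm_sum_le _ _).trans (Finset.sum_le_sum hgbd)))

/-- The union of the disks `closedBall (a n) (a n / (2 * √(n + 1)))` has zero density at `0`. -/
theorem IsSparse.tendsto_volume_div {φ : ℝ → ℝ} {a : ℕ → ℝ} (ha : IsSparse φ a) :
    Tendsto (fun t : ℝ => volume (ball (0 : ℂ) t ∩
      ⋃ n : ℕ, closedBall (a n : ℂ) (a n / (2 * √(n + 1)))) / volume (ball (0 : ℂ) t))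
      (𝓝[>] 0) (𝓝 0) := by
  have key : ∀ M : ℕ, ∀ t : ℝ, 0 < t → t < a M / 2 →
      volume (ball (0 : ℂ) t ∩ ⋃ n : ℕ, closedBall (a n : ℂ) (a n / (2 * √(n + 1)))) /
        volume (ball (0 : ℂ) t) ≤ 2 / (M + 1) := by
    intro M t ht htM
    classical
    have hex := ha.exists_lt (by linarith : 0 < 2 * t)
    set m := Nat.find hex with hmdef
    have hm : a m < 2 * t := Nat.find_spec hex
    have hmin : ∀ n < m, 2 * t ≤ a n := fun n hn => not_lt.1 (Nat.find_min hex hn)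
    have hMm : M ≤ m := by
      by_contra hc
      have := ha.anti (not_le.1 hc).le
      linarith
    have hdec : ∀ j, a (m + j) ≤ 2 * t * (1 / 2) ^ j := by
      intro j
      induction j with
      | zero => simpa using hm.le
      | succ j ih =>
        have h1 := ha.quarter (m + j) (m + (j + 1)) (by omega)
        have h2 := ha.pos (m + j)
        rw [pow_succ]
        linarith
    have hsub : ball (0 : ℂ) t ∩ ⋃ n : ℕ, closedBall (a n : ℂ) (a n / (2 * √(n + 1))) ⊆
        ⋃ j : ℕ, closedBall (a (m + j) : ℂ) (t * (1 / 2) ^ j / √(M + 1)) := by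
      rintro z ⟨hz, hzU⟩
      obtain ⟨n, hn⟩ := mem_iUnion.1 hzU
      rw [mem_closedBall, dist_eq_norm] at hn
      have hz' : ‖z‖ < t := by simpa using hz
      have hpos := ha.pos n
      have hs1 : 1 ≤ √((n : ℝ) + 1) := Real.one_le_sqrt.2 (by linarith [n.cast_nonneg (α := ℝ)])
      have hmn : m ≤ n := by
        by_contra hc
        have h1 := hmin n (not_le.1 hc)
        have h2 := norm_sub_norm_le (a n : ℂ) z
        rw [norm_sub_rev, Complex.norm_real, Real.norm_of_nonneg hpos.le] at h2
        have h3 : a n / (2 * √((n : ℝ) + 1)) ≤ a n / 2 := by gcongr; linarith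
        linarith
      obtain ⟨j, rfl⟩ := Nat.exists_eq_add_of_le hmn
      refine mem_iUnion.2 ⟨j, ?_⟩
      rw [mem_closedBall, dist_eq_norm]
      refine hn.trans ?_
      have h4 : √((M : ℝ) + 1) ≤ √(((m + j : ℕ) : ℝ) + 1) := by
        apply Real.sqrt_le_sqrt
        have : (M : ℝ) ≤ (m + j : ℕ) := by exact_mod_cast hMm.trans hmn
        linarith
      calc a (m + j) / (2 * √(((m + j : ℕ) : ℝ) + 1))
          ≤ 2 * t * (1 / 2) ^ j / (2 * √((M : ℝ) + 1)) := by
            gcongr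
            exact hdec j
        _ = _ := by field_simp
    have hterm : ∀ j : ℕ, volume (closedBall (a (m + j) : ℂ) (t * (1 / 2) ^ j / √(M + 1))) ≤
        volume (ball (0 : ℂ) t) * (ENNReal.ofReal (1 / (M + 1)) * 2⁻¹ ^ j) := by
      intro j
      have e : t * (1 / 2) ^ j / √((M : ℝ) + 1) = t * ((1 / 2) ^ j / √((M : ℝ) + 1)) := by ring
      have e2 : ENNReal.ofReal ((1 / 2) ^ j / √((M : ℝ) + 1)) ^ 2 ≤
          ENNReal.ofReal (1 / (M + 1)) * 2⁻¹ ^ j := by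
        have e3 : (2⁻¹ : ℝ≥0∞) ^ j = ENNReal.ofReal ((1 / 2) ^ j) := by
          rw [ENNReal.ofReal_pow (by norm_num)]
          congr 1
          rw [one_div, ENNReal.ofReal_inv_of_pos (by norm_num)]
          simp
        rw [e3, ← ENNReal.ofReal_pow (by positivity), ← ENNReal.ofReal_mul (by positivity)]
        apply ENNReal.ofReal_le_ofReal
        rw [div_pow, Real.sq_sqrt (by positivity), one_div_mul_eq_div]
        gcongr
        exact pow_le_of_le_one (by positivity)
          (pow_le_one₀ (by norm_num) (by norm_num)) two_ne_zero
      rw [Complex.volume_closedBall, Complex.volume_ball, e, ENNReal.ofReal_mul ht.le, mul_pow,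
        mul_right_comm]
      gcongr
    have hv0 : volume (ball (0 : ℂ) t) ≠ 0 := (measure_ball_pos volume _ ht).ne'
    have hvt : volume (ball (0 : ℂ) t) ≠ ⊤ := measure_ball_lt_top.ne
    rw [ENNReal.div_le_iff hv0 hvt]
    calc _ ≤ ∑' j : ℕ, volume (ball (0 : ℂ) t) * (ENNReal.ofReal (1 / (M + 1)) * 2⁻¹ ^ j) :=
          (measure_mono hsub).trans ((measure_iUnion_le _).trans (ENNReal.tsum_le_tsum hterm))
      _ = 2 / (M + 1) * volume (ball (0 : ℂ) t) := by
          rw [ENNReal.tsum_mul_left, ENNReal.tsum_mul_left, ENNReal.tsum_geometric,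
            ENNReal.one_sub_inv_two, inv_inv, mul_comm]
          congr 1
          rw [ENNReal.ofReal_div_of_pos (by positivity), ENNReal.ofReal_one,
            ENNReal.ofReal_add (by positivity) zero_le_one, ENNReal.ofReal_natCast,
            ENNReal.ofReal_one, ENNReal.div_eq_inv_mul, ENNReal.div_eq_inv_mul, mul_one]
  rw [ENNReal.tendsto_nhds_zero]
  intro ε hε
  have hlim : Tendsto (fun M : ℕ => (2 : ℝ≥0∞) / (M + 1)) atTop (𝓝 0) := by
    have h1 : Tendsto (fun M : ℕ => ((M + 1 : ℕ) : ℝ≥0∞)⁻¹) atTop (𝓝 0) :=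
      ENNReal.tendsto_inv_nat_nhds_zero.comp (tendsto_add_atTop_nat 1)
    have := ENNReal.Tendsto.const_mul (a := 2) h1 (Or.inr (by simp))
    simpa [div_eq_mul_inv] using this
  obtain ⟨M, hM⟩ := (hlim.eventually_lt_const hε).exists
  filter_upwards [Ioo_mem_nhdsGT (half_pos (ha.pos M))] with t ht
  exact (key M t ht.1 ht.2).trans hM.le

/-- An admissible function with limit `0` at `0` admits sparse sequences of the form
`3 / 4 * 2 ^ (-k n)`. -/
theorem IsAdmissible.exists_isSparse {φ : ℝ → ℝ} (hφ : IsAdmissible φ)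
    (hφ0 : Tendsto φ (𝓝[>] 0) (𝓝 0)) :
    ∃ k : ℕ → ℕ, StrictMono k ∧ 1 ≤ k 0 ∧ IsSparse φ fun n => 3 / 4 * ((2 : ℝ) ^ k n)⁻¹ := by
  set b : ℕ → ℝ := fun k => 3 / 4 * ((2 : ℝ) ^ k)⁻¹ with hb
  have hbpos : ∀ k, 0 < b k := fun k => by positivity
  have hblim : Tendsto b atTop (𝓝[>] 0) := by
    rw [tendsto_nhdsWithin_iff]
    refine ⟨?_, Eventually.of_forall hbpos⟩
    have := (tendsto_pow_atTop_nhds_zero_of_lt_one (by norm_num : (0 : ℝ) ≤ 2⁻¹)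
      (by norm_num)).const_mul (3 / 4)
    simpa [hb, inv_pow] using this
  have hφb := hφ0.comp hblim
  have hψb := hφ.assoc_tendsto.comp hblim
  obtain ⟨x, hP, hR⟩ := exists_seq_of_forall_finset_exists
    (fun x : ℕ × ℕ => 1 ≤ x.2 ∧ x.1 ≤ x.2 ∧ φ (b x.2) ≤ 1 / 16)
    (fun x y => x.1 < y.1 ∧ x.2 + 2 ≤ y.2 ∧ φ (b y.2) ≤ φ (b x.2) * (1 / 2) ^ y.1 ∧
      φ (b x.2) / b x.2 ≤ φ (b y.2) / b y.2 * (1 / 4) ^ y.1) (by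
    intro s _
    set N := s.sup Prod.fst + 1
    have hN : ∀ x ∈ s, x.1 < N := fun x hx => Nat.lt_succ_of_le (Finset.le_sup (f := Prod.fst) hx)
    have hev : ∀ x ∈ s, ∀ᶠ k in atTop, x.2 + 2 ≤ k ∧ φ (b k) ≤ φ (b x.2) * (1 / 2) ^ N ∧
        φ (b x.2) / b x.2 ≤ φ (b k) / b k * (1 / 4) ^ N := by
      intro x _
      have hpx := hφ.pos _ (hbpos x.2)
      have hbx := hbpos x.2
      refine (eventually_ge_atTop _).and (Eventually.and ?_ ?_)
      · exact (hφb.eventually_lt_const (by positivity : 0 < φ (b x.2) * (1 / 2) ^ N)).mono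
          fun k hk => hk.le
      · filter_upwards [hψb.eventually_lt_const
          (by positivity : 0 < (1 / 4) ^ N * (b x.2 / φ (b x.2)))] with k hk
        simp only [Function.comp] at hk
        have hpk := hφ.pos _ (hbpos k)
        have hbk := hbpos k
        have := hk.le
        rw [← mul_div_assoc, div_le_div_iff₀ hpk hpx] at this
        rw [div_mul_eq_mul_div, div_le_div_iff₀ hbx hbk]
        linarith
    obtain ⟨k, h1, h2, h3, h4⟩ := (((Finset.eventually_all s).2 hev).and
      ((eventually_ge_atTop 1).and ((eventually_ge_atTop N).and
        (hφb.eventually_lt_const (by norm_num : (0 : ℝ) < 1 / 16))))).exists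
    exact ⟨(N, k), ⟨h2, h3, h4.le⟩, fun x hx => ⟨hN x hx, h1 x hx⟩⟩)
  have hx1 : ∀ n, n ≤ (x n).1 := fun n =>
    StrictMono.le_apply (f := fun n => (x n).1) fun i j hij => (hR i j hij).1
  have hkn : ∀ n, n ≤ (x n).2 := fun n => (hx1 n).trans (hP n).2.1
  have hanti : Antitone fun k : ℕ => ((2 : ℝ) ^ k)⁻¹ := fun i j hij =>
    inv_anti₀ (by positivity) (pow_le_pow_right₀ one_le_two hij)
  refine ⟨fun n => (x n).2, fun i j hij => by have := (hR i j hij).2.1; simp only; omega, (hP 0).1,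
    ⟨fun n => hbpos _, fun n => ?_, fun n => ?_, fun i j hij => ?_, fun n => (hP n).2.2,
      fun i j hij => (hR i j hij).2.2.1.trans ?_, fun i j hij => (hR i j hij).2.2.2.trans ?_⟩⟩
  · have h1 : ((2 : ℝ) ^ (x n).2)⁻¹ ≤ (2 ^ n)⁻¹ := hanti (hkn n)
    have h2 : (0 : ℝ) < (2 ^ n)⁻¹ := by positivity
    rw [one_div, inv_pow]
    linarith
  · have h1 : ((2 : ℝ) ^ (x n).2)⁻¹ ≤ (2 ^ 1)⁻¹ := hanti (hP n).1
    norm_num at h1 ⊢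
    linarith
  · have h1 : ((2 : ℝ) ^ (x j).2)⁻¹ ≤ (2 ^ ((x i).2 + 2))⁻¹ := hanti (hR i j hij).2.1
    rw [pow_add, mul_inv] at h1
    norm_num at h1 ⊢
    linarith
  · have := hφ.pos _ (hbpos (x i).2)
    exact mul_le_mul_of_nonneg_left
      (pow_le_pow_of_le_one (by norm_num) (by norm_num) (hx1 j)) this.le
  · have := hφ.pos _ (hbpos (x j).2)
    have h2 := hbpos (x j).2
    exact mul_le_mul_of_nonneg_left
      (pow_le_pow_of_le_one (by norm_num) (by norm_num) (hx1 j)) (by positivity)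

theorem le_mul_of_rpow_le {α r a c : ℝ} (hα0 : 0 ≤ α) (hα1 : α ≤ 1) (hr : 0 ≤ r) (ha : 0 < a)
    (ha1 : a ≤ 1) (hc : 0 < c) (hc1 : c ≤ 1) (h : r ^ (1 + α) ≤ a ^ 2 * c ^ 2) : r ≤ a * c := by
  have h1 : (a * c) ^ (2 : ℝ) ≤ (a * c) ^ (1 + α) :=
    Real.rpow_le_rpow_of_exponent_ge (by positivity) (mul_le_one₀ ha1 hc.le hc1) (by linarith)
  rw [Real.rpow_two, mul_pow] at h1
  exact (Real.rpow_le_rpow_iff hr (by positivity) (by linarith)).1 (h.trans h1)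

theorem tsum_ofReal_const_div_eq_top {c : ℝ} (hc : 0 < c) :
    ∑' n : ℕ, ENNReal.ofReal (c / (n + 1)) = ⊤ := by
  by_contra h
  have h1 := ENNReal.summable_toReal h
  have h2 : (fun n : ℕ => (ENNReal.ofReal (c / ((n : ℝ) + 1))).toReal) =
      fun n : ℕ => c * (1 / ((n + 1 : ℕ) : ℝ)) := by
    ext n
    rw [ENNReal.toReal_ofReal (by positivity)]
    push_cast
    ring
  rw [h2, summable_mul_left_iff hc.ne', summable_nat_add_iff (f := fun n : ℕ => 1 / (n : ℝ)) 1]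
    at h1
  exact Real.not_summable_one_div_natCast h1

section Disks

variable {φ : ℝ → ℝ} {a r : ℕ → ℝ}

theorem IsSparse.norm_coe (ha : IsSparse φ a) (n : ℕ) : ‖(a n : ℂ)‖ = a n := by
  simp [abs_of_pos (ha.pos n)]

theorem IsSparse.norm_bounds (ha : IsSparse φ a) (hr : ∀ n, r n ≤ a n / 4) {n : ℕ} {z : ℂ}
    (hz : z ∈ closedBall (a n : ℂ) (r n)) : 3 / 4 * a n ≤ ‖z‖ ∧ ‖z‖ ≤ 5 / 4 * a n := by
  rw [mem_closedBall, dist_eq_norm] at hz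
  have h1 := norm_sub_norm_le z (a n : ℂ)
  have h2 := norm_sub_norm_le (a n : ℂ) z
  rw [norm_sub_rev] at h2
  rw [ha.norm_coe] at h1 h2
  have := hr n
  constructor <;> linarith

theorem IsSparse.disjoint_closedBall (ha : IsSparse φ a) (hr : ∀ n, r n ≤ a n / 4) {i j : ℕ}
    (hij : i ≠ j) : Disjoint (closedBall (a i : ℂ) (r i)) (closedBall (a j : ℂ) (r j)) := by
  rw [Set.disjoint_left]
  intro z hi hj
  have h1 := ha.norm_bounds hr hi
  have h2 := ha.norm_bounds hr hj
  have := ha.pos i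
  have := ha.pos j
  rcases lt_or_gt_of_ne hij with h | h
  · linarith [ha.quarter i j h]
  · linarith [ha.quarter j i h]

theorem IsSparse.zero_mem (ha : IsSparse φ a) (hr : ∀ n, r n ≤ a n / 4) :
    (0 : ℂ) ∈ perforatedDisk a r := by
  refine ⟨by simp, fun h => ?_⟩
  obtain ⟨n, hn⟩ := mem_iUnion.1 h
  have := (ha.norm_bounds hr hn).1
  rw [norm_zero] at this
  linarith [ha.pos n]

/-- Away from the origin only finitely many of the disks matter. -/
theorem IsSparse.exists_finite (ha : IsSparse φ a) (hr : ∀ n, r n ≤ a n / 4) {ρ : ℝ}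
    (hρ : 0 < ρ) : ∃ N : ℕ, ∀ z : ℂ, ρ ≤ ‖z‖ →
      z ∈ ball (0 : ℂ) 1 \ ⋃ n ∈ Finset.range N, closedBall (a n : ℂ) (r n) →
      z ∈ perforatedDisk a r := by
  obtain ⟨N, hN⟩ := ha.exists_lt (half_pos hρ)
  refine ⟨N, fun z hz hzN => ⟨hzN.1, fun h => ?_⟩⟩
  obtain ⟨n, hn⟩ := mem_iUnion.1 h
  rcases lt_or_ge n N with h' | h'
  · exact hzN.2 (mem_biUnion (x := n) (by simpa using h') hn)
  · have h1 := (ha.norm_bounds hr hn).2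
    have h2 := ha.anti h'
    linarith

theorem IsSparse.isOpen_diff (ha : IsSparse φ a) (hr : ∀ n, r n ≤ a n / 4) :
    IsOpen (perforatedDisk a r \ {0}) := by
  rw [isOpen_iff_mem_nhds]
  rintro z ⟨hz, hz0⟩
  have hzpos : 0 < ‖z‖ := norm_pos_iff.2 hz0
  obtain ⟨N, hN⟩ := ha.exists_finite hr (half_pos hzpos)
  have ho : IsOpen ((ball (0 : ℂ) 1 \ ⋃ n ∈ Finset.range N, closedBall (a n : ℂ) (r n)) \
      closedBall 0 (‖z‖ / 2)) :=
    (isOpen_ball.sdiff (isClosed_biUnion_finset fun _ _ => isClosed_closedBall)).sdiff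
      isClosed_closedBall
  refine mem_of_superset (ho.mem_nhds ⟨⟨hz.1, fun h => ?_⟩, ?_⟩) ?_
  · obtain ⟨n, _, hn⟩ := mem_iUnion₂.1 h
    exact hz.2 (mem_iUnion.2 ⟨n, hn⟩)
  · simpa using hzpos
  · rintro w ⟨hw, hw2⟩
    rw [mem_closedBall_zero_iff, not_le] at hw2
    refine ⟨hN w hw2.le hw, fun h => ?_⟩
    rw [mem_singleton_iff.1 h, norm_zero] at hw2
    linarith

/-- Uniform first-order Taylor estimate at `0` for functions in `A_α(U)`, away from the points
`a n`. -/
theorem IsSparse.norm_taylor_le (hφ : IsAdmissible φ) (ha : IsSparse φ a) {α : ℝ≥0} (hα : 0 < α)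
    (hr : ∀ n, 0 < r n) (hpow : ∀ n, r n ^ (1 + (α : ℝ)) = a n ^ 2 * ((n : ℝ) + 1)⁻¹ * φ (a n))
    (hle : ∀ n, r n ≤ a n / (4 * √(n + 1))) {ε : ℝ} (hε : 0 < ε) :
    ∃ R > 0, ∀ y : ℂ, ‖y‖ < R → (∀ n, a n / (2 * √(n + 1)) ≤ ‖y - a n‖) →
      ∀ f ∈ analyticLip α (perforatedDisk a r),
        ‖f y - f 0 - deriv f 0 * y‖ ≤ ε * φ ‖y‖ * ‖y‖ * lipNorm α f := by
  have hr4 : ∀ n, r n ≤ a n / 4 := fun n => (hle n).trans (by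
    have h1 : 1 ≤ √((n : ℝ) + 1) := Real.one_le_sqrt.2 (by linarith [n.cast_nonneg (α := ℝ)])
    have := ha.pos n
    gcongr
    linarith)
  obtain ⟨R₁, hR₁, hsum⟩ := ha.sum_interaction_le hφ (by positivity : 0 < ε / 8)
  obtain ⟨R₂, hR₂, hψ⟩ := mem_nhdsGT_iff_exists_Ioo_subset.1
    (hφ.assoc_tendsto.eventually_lt_const (by positivity : 0 < ε / 12))
  have hR₂ : 0 < R₂ := hR₂
  refine ⟨min (1 / 4) (min R₁ R₂), by positivity, fun y hyR hy f hf => ?_⟩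
  rcases eq_or_ne y 0 with rfl | hy0
  · simp
  have hρ : 0 < ‖y‖ := norm_pos_iff.2 hy0
  obtain ⟨hy4, hyR⟩ := lt_min_iff.1 hyR
  obtain ⟨hy1, hy2⟩ := lt_min_iff.1 hyR
  have hφρ := hφ.pos _ hρ
  have hψy : ‖y‖ / φ ‖y‖ < ε / 12 := hψ ⟨hρ, hy2⟩
  rw [div_lt_iff₀ hφρ] at hψy
  obtain ⟨⟨⟨hhol, hbdd⟩, _⟩, han⟩ := hf
  obtain ⟨ρ, hρ0, hρan⟩ := Metric.eventually_nhds_iff_ball.1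
    (han 0 (ha.zero_mem hr4)).eventually_analyticAt
  obtain ⟨N, hN⟩ := ha.exists_finite hr4 hρ0
  have hd : DifferentiableOn ℂ f
      (ball 0 1 \ ⋃ n ∈ Finset.range N, closedBall (a n : ℂ) (r n)) := by
    intro z hz
    refine DifferentiableAt.differentiableWithinAt (AnalyticAt.differentiableAt ?_)
    rcases lt_or_ge ‖z‖ ρ with h | h
    · exact hρan z (by simpa using h)
    · exact han z (hN z h hz)
  have hB : ∀ z, ‖f z‖ ≤ ⨆ z, ‖f z‖ := fun z => le_ciSup hbdd z
  have hyr : ∀ n ∈ Finset.range N, 2 * r n ≤ ‖y - a n‖ := fun n _ => by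
    have h1 : 2 * r n ≤ 2 * (a n / (4 * √(n + 1))) := by linarith [hle n]
    refine h1.trans (le_trans (le_of_eq ?_) (hy n))
    field_simp
    ring
  have hmain := norm_taylor_le_of_differentiableOn_diff hα hhol.holderWith hB
    (fun n _ => ha.le_three_eighths n) (fun n _ => hr n) (fun n _ => hr4 n)
    (fun i _ j _ hij => ha.disjoint_closedBall hr4 hij) hd hy4.le hyr
  set K : ℝ := (nnHolderNorm α f : ℝ) with hK
  set B : ℝ := ⨆ z, ‖f z‖ with hBdef
  have hK0 : 0 ≤ K := NNReal.coe_nonneg _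
  have hB0 : 0 ≤ B := (norm_nonneg _).trans (hB 0)
  have hS1 : ∑ n ∈ Finset.range N, r n ^ (1 + (α : ℝ)) ≤ 1 / 8 := by
    have : ∀ n, r n ^ (1 + (α : ℝ)) ≤ 1 / 16 * (1 / 2) ^ n := fun n => by
      have h0 := ha.pos n
      have h1 : a n ^ 2 ≤ (1 / 2) ^ n := by
        nlinarith [ha.le_pow n, ha.le_three_eighths n]
      have h2 : ((n : ℝ) + 1)⁻¹ ≤ 1 := inv_le_one_of_one_le₀ (by linarith [n.cast_nonneg (α := ℝ)])
      rw [hpow n]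
      calc a n ^ 2 * ((n : ℝ) + 1)⁻¹ * φ (a n) ≤ (1 / 2) ^ n * 1 * (1 / 16) := by
            have := (hφ.pos _ h0).le
            gcongr
            exact ha.phi_le n
        _ = _ := by ring
    calc _ ≤ ∑ n ∈ Finset.range N, 1 / 16 * (1 / 2 : ℝ) ^ n := Finset.sum_le_sum fun n _ => this n
      _ ≤ 1 / 8 := by
        rw [← Finset.mul_sum]
        linarith [IsSparse.sum_half_pow_le N]
  have hS2 : ∑ n ∈ Finset.range N, r n ^ (1 + (α : ℝ)) / (a n ^ 2 * ‖y - a n‖) ≤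
      ε / 8 * (φ ‖y‖ / ‖y‖) := by
    refine le_trans (le_of_eq (Finset.sum_congr rfl fun n _ => ?_)) (hsum y hy0 hy1 hy N)
    have h0 := (ha.pos n).ne'
    have h1 : 0 < ‖y - a n‖ := lt_of_lt_of_le (by have := ha.pos n; positivity) (hy n)
    rw [hpow n]
    field_simp
  have hS2' : ‖y‖ ^ 2 * ∑ n ∈ Finset.range N, r n ^ (1 + (α : ℝ)) / (a n ^ 2 * ‖y - a n‖) ≤
      ε / 8 * (φ ‖y‖ * ‖y‖) := by
    refine (mul_le_mul_of_nonneg_left hS2 (by positivity)).trans (le_of_eq ?_)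
    field_simp
  have hy2' : ‖y‖ ^ 2 ≤ ε / 12 * (φ ‖y‖ * ‖y‖) := by nlinarith
  have hB1 : B + 4 * K * ∑ n ∈ Finset.range N, r n ^ (1 + (α : ℝ)) ≤ K + B := by
    nlinarith
  calc _ ≤ _ := hmain
    _ = 3 * ‖y‖ ^ 2 * (B + 4 * K * ∑ n ∈ Finset.range N, r n ^ (1 + (α : ℝ))) +
      4 * K * (‖y‖ ^ 2 *
        ∑ n ∈ Finset.range N, r n ^ (1 + (α : ℝ)) / (a n ^ 2 * ‖y - a n‖)) := by ring
    _ ≤ 3 * (ε / 12 * (φ ‖y‖ * ‖y‖)) * (K + B) + 4 * (K + B) * (ε / 8 * (φ ‖y‖ * ‖y‖)) := by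
      have := mul_le_mul_of_nonneg_left hB1 (sq_nonneg ‖y‖)
      have hKB : 0 ≤ K + B := add_nonneg hK0 hB0
      have h1 : 3 * ‖y‖ ^ 2 * (B + 4 * K * ∑ n ∈ Finset.range N, r n ^ (1 + (α : ℝ))) ≤
          3 * (ε / 12 * (φ ‖y‖ * ‖y‖)) * (K + B) :=
        le_trans (by linarith) (mul_le_mul_of_nonneg_right
          (mul_le_mul_of_nonneg_left hy2' (by norm_num : (0 : ℝ) ≤ 3)) hKB)
      exact add_le_add h1 ((mul_le_mul_of_nonneg_left hS2' (by positivity)).trans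
        (mul_le_mul_of_nonneg_right (by linarith) (by positivity)))
    _ = 3 / 4 * (ε * φ ‖y‖ * ‖y‖ * lipNorm α f) := by
      simp only [lipNorm, ← hK, ← hBdef]
      ring
    _ ≤ ε * φ ‖y‖ * ‖y‖ * lipNorm α f := by
      have : 0 ≤ lipNorm α f := add_nonneg hK0 hB0
      have : 0 ≤ ε * φ ‖y‖ * ‖y‖ * lipNorm α f := by positivity
      linarith

theorem IsSparse.hasFullAreaDensity (hφ : IsAdmissible φ) (ha : IsSparse φ a) {α : ℝ≥0}
    (hα : 0 < α) (hr : ∀ n, 0 < r n)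
    (hpow : ∀ n, r n ^ (1 + (α : ℝ)) = a n ^ 2 * ((n : ℝ) + 1)⁻¹ * φ (a n))
    (hle : ∀ n, r n ≤ a n / (4 * √(n + 1))) {ε : ℝ} (hε : 0 < ε) :
    HasFullAreaDensity {y | y ∈ perforatedDisk a r ∧ ∀ f ∈ analyticLip α (perforatedDisk a r),
      ‖f y - f 0 - deriv f 0 * y‖ ≤ ε * φ ‖y‖ * ‖y‖ * lipNorm α f} 0 := by
  obtain ⟨R, hR, hest⟩ := ha.norm_taylor_le hφ hα hr hpow hle hε
  refine tendsto_of_tendsto_of_tendsto_of_le_of_le' tendsto_const_nhds ha.tendsto_volume_div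
    (Eventually.of_forall fun _ => zero_le) ?_
  filter_upwards [Ioo_mem_nhdsGT (lt_min hR one_pos)] with t ht
  refine ENNReal.div_le_div_right (measure_mono ?_) _
  rintro y ⟨hyt, hyE⟩
  refine ⟨hyt, ?_⟩
  by_contra hbad
  have hbad' : ∀ n : ℕ, a n / (2 * √(n + 1)) < ‖y - a n‖ := by
    simpa [dist_eq_norm] using hbad
  have hyt' : ‖y‖ < t := by simpa using hyt
  obtain ⟨htR, ht1⟩ := lt_min_iff.1 ht.2
  refine hyE ⟨⟨by simpa using hyt'.trans ht1, fun h => ?_⟩,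
    hest y (hyt'.trans htR) fun n => (hbad' n).le⟩
  obtain ⟨n, hn⟩ := mem_iUnion.1 h
  rw [mem_closedBall, dist_eq_norm] at hn
  have h0 := ha.pos n
  have h1 : a n / (4 * √((n : ℝ) + 1)) ≤ a n / (2 * √(n + 1)) := by gcongr; norm_num
  linarith [hbad' n, hle n]

theorem tsum_lowerHausdorffContent_eq_top (hφ : IsAdmissible φ) {α : ℝ≥0} (hα1 : α < 1)
    {k : ℕ → ℕ} (hk : StrictMono k) (hk0 : 1 ≤ k 0) (hak : ∀ n, a n = 3 / 4 * ((2 : ℝ) ^ k n)⁻¹)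
    (hr : ∀ n, 0 < r n) (hpow : ∀ n, r n ^ (1 + (α : ℝ)) = a n ^ 2 * ((n : ℝ) + 1)⁻¹ * φ (a n))
    (hann : ∀ n, closedBall (a n : ℂ) (r n) ⊆ annulus 0 (k n)) :
    ∑' n : ℕ, ENNReal.ofReal ((φ (((2 : ℝ) ^ (n + 1))⁻¹))⁻¹ * 4 ^ (n + 1)) *
      lowerHausdorffContent (1 + (α : ℝ)) (annulus 0 (n + 1) \ perforatedDisk a r) = ⊤ := by
  have hk1 : ∀ n, 1 ≤ k n := fun n => hk0.trans (hk.monotone (Nat.zero_le n))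
  have hinj : Function.Injective fun n => k n - 1 := fun i j hij => hk.injective (by
    have := hk1 i
    have := hk1 j
    simp only at hij
    omega)
  rw [eq_top_iff, ← tsum_ofReal_const_div_eq_top (by norm_num : (0 : ℝ) < 9 / 32)]
  refine le_trans (ENNReal.tsum_le_tsum fun n => ?_) (ENNReal.tsum_comp_le_tsum_of_injective hinj _)
  have hkn : k n - 1 + 1 = k n := Nat.sub_add_cancel (hk1 n)
  simp only [hkn]
  have hcont : ENNReal.ofReal (r n ^ (1 + (α : ℝ))) ≤
      lowerHausdorffContent (1 + (α : ℝ)) (annulus 0 (k n) \ perforatedDisk a r) := by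
    obtain ⟨ρ, hρ⟩ : ∃ ρ : ℝ≥0, (ρ : ℝ) = r n := ⟨⟨r n, (hr n).le⟩, rfl⟩
    have hρ0 : 0 < ρ := by
      have := hr n
      rw [← hρ] at this
      exact_mod_cast this
    have h1 := rpow_le_lowerHausdorffContent_closedBall hα1 (a n : ℂ) hρ0
    rw [← ENNReal.ofReal_coe_nnreal, NNReal.coe_rpow, hρ] at h1
    refine h1.trans (lowerHausdorffContent_mono _ fun z hz => ⟨hann n hz, fun h => ?_⟩)
    exact h.2 (mem_iUnion.2 ⟨n, hz⟩)
  refine le_trans ?_ (mul_le_mul_right hcont _)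
  have hp2 : (0 : ℝ) < ((2 : ℝ) ^ k n)⁻¹ := by positivity
  have hφ2 := hφ.pos _ hp2
  have han : 0 < a n := by rw [hak]; positivity
  have hφa := hφ.pos _ han
  have hdbl : φ ((2 : ℝ) ^ k n)⁻¹ ≤ 2 * φ (a n) :=
    hφ.le_two_mul han hp2 (by rw [hak]; linarith)
  rw [← ENNReal.ofReal_mul (by positivity), hpow n]
  apply ENNReal.ofReal_le_ofReal
  have h4 : (4 : ℝ) ^ k n * a n ^ 2 = 9 / 16 := by
    rw [hak, mul_pow, inv_pow, ← pow_mul, mul_comm (k n), pow_mul]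
    norm_num
    field_simp
  calc 9 / 32 / ((n : ℝ) + 1) = 9 / 16 / (n + 1) * (1 / 2) := by ring
    _ ≤ 9 / 16 / (n + 1) * ((φ ((2 : ℝ) ^ k n)⁻¹)⁻¹ * φ (a n)) := by
      gcongr
      rw [← div_eq_inv_mul, le_div_iff₀ hφ2]
      linarith
    _ = _ := by rw [← h4]; ring

end Disks

end LipAnalytic

end

theorem theorem4p1 (φ : ℝ → ℝ) (hφ : IsAdmissible φ) (hφ0 : Tendsto φ (𝓝[>] 0) (𝓝 0))
    (α : ℝ≥0) (hα0 : 0 < α) (hα1 : α < 1) :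
    ∃ (k : ℕ → ℕ) (a r : ℕ → ℝ) (U : Set ℂ),
      -- the `n`-th disk (counting from `n + 1 = 1`) is centred in the annulus `A_{k n}(0)`
      StrictMono k ∧ 1 ≤ k 0 ∧
      (∀ n, a n = 3 / 4 * ((2 : ℝ) ^ k n)⁻¹) ∧
      (∀ n, 0 < r n ∧ r n ^ (1 + (α : ℝ)) = a n ^ 2 * ((n : ℝ) + 1)⁻¹ * φ (a n)) ∧
      (∀ n, closedBall (a n : ℂ) (r n) ⊆ annulus 0 (k n)) ∧
      U = perforatedDisk a r ∧ (0 : ℂ) ∈ U ∧ IsOpen (U \ {0}) ∧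
      (∀ ε : ℝ, 0 < ε →
        HasFullAreaDensity
          {y | y ∈ U ∧ ∀ f ∈ analyticLip α U,
            ‖f y - f 0 - deriv f 0 * y‖ ≤ ε * φ ‖y‖ * ‖y‖ * lipNorm α f} 0) ∧
      ∑' n : ℕ, ENNReal.ofReal ((φ (((2 : ℝ) ^ (n + 1))⁻¹))⁻¹ * 4 ^ (n + 1)) *
        lowerHausdorffContent (1 + (α : ℝ)) (annulus 0 (n + 1) \ U) = ⊤ := by

  obtain ⟨k, hk, hk0, ha⟩ := hφ.exists_isSparse hφ0
  set a : ℕ → ℝ := fun n => 3 / 4 * ((2 : ℝ) ^ k n)⁻¹ with hadef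
  have hα0' : 0 ≤ (α : ℝ) := α.coe_nonneg
  have hα1' : (α : ℝ) < 1 := by exact_mod_cast hα1
  have hbase : ∀ n : ℕ, 0 < a n ^ 2 * ((n : ℝ) + 1)⁻¹ * φ (a n) := fun n => by
    have h0 := ha.pos n
    have := hφ.pos _ h0
    positivity
  set r : ℕ → ℝ := fun n => (a n ^ 2 * ((n : ℝ) + 1)⁻¹ * φ (a n)) ^ (1 + (α : ℝ))⁻¹ with hrdef
  have hr : ∀ n, 0 < r n := fun n => Real.rpow_pos_of_pos (hbase n) _
  have hpow : ∀ n, r n ^ (1 + (α : ℝ)) = a n ^ 2 * ((n : ℝ) + 1)⁻¹ * φ (a n) := fun n =>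
    Real.rpow_inv_rpow (hbase n).le (by positivity)
  have hle : ∀ n, r n ≤ a n / (4 * √((n : ℝ) + 1)) := fun n => by
    have h0 := ha.pos n
    have h1 : 1 ≤ √((n : ℝ) + 1) := Real.one_le_sqrt.2 (by linarith [n.cast_nonneg (α := ℝ)])
    rw [div_eq_mul_inv]
    refine le_mul_of_rpow_le hα0' hα1'.le (hr n).le h0 (by linarith [ha.le_three_eighths n])
      (by positivity) (inv_le_one_of_one_le₀ (by linarith)) ?_
    rw [hpow n, inv_pow, mul_pow 4, Real.sq_sqrt (by positivity), mul_inv,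
      mul_comm ((4 : ℝ) ^ 2)⁻¹, mul_assoc]
    gcongr
    exact (ha.phi_le n).trans (by norm_num)
  have hr4 : ∀ n, r n ≤ a n / 4 := fun n => (hle n).trans (by
    have h1 : 1 ≤ √((n : ℝ) + 1) := Real.one_le_sqrt.2 (by linarith [n.cast_nonneg (α := ℝ)])
    have := ha.pos n
    gcongr
    linarith)
  have hann : ∀ n, closedBall (a n : ℂ) (r n) ⊆ annulus 0 (k n) := fun n z hz => by
    have h := ha.norm_bounds hr4 hz
    have h2 : (0 : ℝ) < ((2 : ℝ) ^ k n)⁻¹ := by positivity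
    simp only [hadef] at h
    simp only [annulus, mem_ofPred_eq, sub_zero, pow_succ, mul_inv]
    constructor <;> linarith
  exact ⟨k, a, r, perforatedDisk a r, hk, hk0, fun n => rfl, fun n => ⟨hr n, hpow n⟩, hann, rfl,
    ha.zero_mem hr4, ha.isOpen_diff hr4,
    fun ε hε => ha.hasFullAreaDensity hφ hα0 hr hpow hle hε,
    tsum_lowerHausdorffContent_eq_top hφ hα1 hk hk0 (fun n => rfl) hr hpow hann⟩
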